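/- Let $\mathbb T=\mathbb R/2\pi\mathbb Z$ and, for $f:\mathbb T\to\mathbb R$, let $$\Lambda^{-1}f(\alpha)=-\frac1{2\pi}\int_{-\pi}^{\pi}\log\Big(4\sin^2\Big(\frac{\alpha-\beta}2\Big)\Big)f(\beta)\,d\beta ,\qquad \hat f(k)=\frac1{2\pi}\int_{\mathbb T}f(\alpha)e^{-ik\alpha}\,d\alpha ,$$ $$\|f\|_{\dot H^4}^2=2\pi\sum_{k\in\mathbb Z}|k|^{8}|\hat f(k)|^2,\qquad \|f\|_{H^4}^2=2\pi\sum_{k\in\mathbb Z}(1+k^2)^{4}|\hat f(k)|^2 .$$ **Theorem (Existence of solutions for small data, quadratic model).** There exist constants $\varepsilon>0$ and $C>0$ such that for every real-valued $u_0\in\dot H^4(\mathbb T)$ with zero mean, $\int_{\mathbb T}u_0\,d\alpha=0$, and $\|u_0\|_{\dot H^4(\mathbb T)}\le\varepsilon$, there exists a function $u:[0,\infty)\times\mathbb T\to\mathbb R$ with $u\in C([0,T],H^4(\mathbb T))$ for every $T>0$ which solves the Cauchy problem $$u_t+u\,u_\alpha=-\Lambda^{-1}u\quad\text{on }[0,\infty)\times\mathbb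 T,\qquad u(0)=u_0,$$ the equation holding pointwise for every $t\ge 0$ and $\alpha\in\mathbb T$ (with the one-sided time derivative at $t=0$). Furthermore, $$\|u(t)\|_{L^2(\mathbb T)}\le C(1+t)^{-2.25}\qquad\text{for all }t\ge0 .$$ -/

import Mathlib

open MeasureTheory Filter Topology

instance factTwoPiPos : Fact (0 < 2 * Real.pi) := ⟨Real.two_pi_pos⟩

/-- The one-dimensional torus `ℝ / 2πℤ`; its `volume` is Lebesgue measure, of total mass `2π`. -/
abbrev Torus : Type := AddCircle (2 * Real.pi)

/-- `hat f k = (1 / 2π) ∫ f(α) exp(-i k α) dα`. -/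
noncomputable def hat (f : Torus → ℝ) (k : ℤ) : ℂ :=
  fourierCoeff (fun α => (f α : ℂ)) k

/-- Membership in the homogeneous Sobolev space of integer order `s`. -/
def MemHomSobolev (s : ℕ) (f : Torus → ℝ) : Prop :=
  MemLp f 2 volume ∧ Summable fun k : ℤ => |(k : ℝ)| ^ (2 * s) * ‖hat f k‖ ^ 2

/-- The homogeneous Sobolev (semi)norm; by Parseval it is the `L²(dα)` norm of the derivative of
order `s`. -/
noncomputable def homSobolevNorm (s : ℕ) (f : Torus → ℝ) : ℝ :=
  Real.sqrt (2 * Real.pi * ∑' k : ℤ, |(k : ℝ)| ^ (2 * s) * ‖hat f k‖ ^ 2)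

/-- Membership in the (inhomogeneous) Sobolev space of integer order `s`. -/
def MemSobolev (s : ℕ) (f : Torus → ℝ) : Prop :=
  MemLp f 2 volume ∧ Summable fun k : ℤ => (1 + (k : ℝ) ^ 2) ^ s * ‖hat f k‖ ^ 2

/-- The (inhomogeneous) Sobolev norm of integer order `s`. -/
noncomputable def sobolevNorm (s : ℕ) (f : Torus → ℝ) : ℝ :=
  Real.sqrt (2 * Real.pi * ∑' k : ℤ, (1 + (k : ℝ) ^ 2) ^ s * ‖hat f k‖ ^ 2)

/-- `u ∈ C([0, T], H^s)`: a curve in `H^s` that is continuous for the norm of `H^s`. -/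
def ContinuousInSobolev (s : ℕ) (T : ℝ) (u : ℝ → Torus → ℝ) : Prop :=
  (∀ t ∈ Set.Icc 0 T, MemSobolev s (u t)) ∧
  ∀ t₀ ∈ Set.Icc 0 T,
    Tendsto (fun t => sobolevNorm s (fun α => u t α - u t₀ α)) (𝓝[Set.Icc 0 T] t₀) (𝓝 0)

/-- The operator `Λ⁻¹`,
`Λ⁻¹ f (α) = -(1 / 2π) ∫_{-π}^{π} log (4 sin² ((α - β) / 2)) f(β) dβ`. -/
noncomputable def invLambda (f : Torus → ℝ) (α : ℝ) : ℝ :=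
  -(1 / (2 * Real.pi)) * ∫ β in (-Real.pi)..Real.pi,
    Real.log (4 * Real.sin ((α - β) / 2) ^ 2) * f (β : Torus)

/-- `u` solves `u_t + u u_α = -Λ⁻¹ u` on `[0, T]`, pointwise everywhere, with initial datum `u₀`
(an element of `L²`, so that it is attained almost everywhere). At the end points of `[0, T]` the
time derivative is one-sided. -/
structure IsQuadraticSolution (T : ℝ) (u₀ : Torus → ℝ) (u : ℝ → Torus → ℝ) : Prop where
  initial : u 0 =ᵐ[volume] u₀
  equation : ∀ t ∈ Set.Icc 0 T, ∀ α : ℝ, ∃ ut uα : ℝ,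
    HasDerivWithinAt (fun τ : ℝ => u τ (α : Torus)) ut (Set.Icc 0 T) t ∧
    HasDerivAt (fun x : ℝ => u t (x : Torus)) uα α ∧
    ut + u t (α : Torus) * uα = -invLambda (u t) α

/-! On Fourier coefficients the equation reads `a_k' = -a_k / |k| - (i k / 2) ∑ a_j a_(k-j)`. Put `Y
= ∑ |a_k|²`, `M = ∑ k⁸ |a_k|²` and `H = ∑ |a_k|² / |k|`. The quadratic term conserves `Y`, so `Y' =
-2 H`. In `M'` the cubic term, symmetrised over triples of frequencies with sum zero, puts only one
derivative on the lowest frequency (`abs_weight_sum_le`). With `∑ |k| |a_k| ≲ (Y M)^(1/4)` this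
gives `M' ≤ K (Y M)^(1/4) M`.

The dissipation `H` is weaker than `Y`, but splitting frequencies at `R` gives `Y ≤ R H + M / R⁸`.
For `p = Y^(1/8)` and `q = M^(1/8)` this becomes `p' ≤ -p² / (16 q)` and `q' ≤ (K / 8) p² q³`. Hence
`q⁻³ - 6 K p` is nondecreasing. For small data `q` stays bounded, and then `p ≲ 1 / (1 + t)`, that
is, `√Y ≲ (1 + t)⁻⁴` (`energy_decay`).

These estimates hold for Galerkin truncations uniformly in the cutoff. Since `M` bounds each
coefficient by a multiple of `(1 + |k|)⁻⁴`, coefficientwise limits along an ultrafilter pass through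
the convolution (`exists_isFourierSolution`). Continuity in `H⁴` needs tails that are small
uniformly in time: the weight `x⁸ min (1, |x| / n)` obeys the same cubic estimate with a constant
independent of `n`, so Grönwall bounds the tail by that of the datum. Finally the Fourier integrals
of the logarithmic kernel identify `Λ⁻¹` with the multiplier `1 / |k|` (`invLambda_realFourierSum`).
-/

/-! ### Weights and the symmetrised symbol -/

/-- The truncated weight `min (1, |x| / n)`. -/
noncomputable def cutWeight (n x : ℝ) : ℝ := min 1 (|x| / n)

/-- The weight `x⁸ min (1, |x| / n)`. -/
noncomputable def sobWeight (n x : ℝ) : ℝ := x ^ 8 * cutWeight n x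

lemma cutWeight_nonneg {n : ℝ} (hn : 0 < n) (x : ℝ) : 0 ≤ cutWeight n x :=
  le_min zero_le_one (by positivity)

lemma cutWeight_le_one (n x : ℝ) : cutWeight n x ≤ 1 := min_le_left _ _

lemma cutWeight_neg (n x : ℝ) : cutWeight n (-x) = cutWeight n x := by simp [cutWeight]

lemma cutWeight_mono {n : ℝ} (hn : 0 < n) {x y : ℝ} (h : |x| ≤ |y|) :
    cutWeight n x ≤ cutWeight n y := by
  unfold cutWeight
  gcongr

lemma sobWeight_nonneg {n : ℝ} (hn : 0 < n) (x : ℝ) : 0 ≤ sobWeight n x :=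
  mul_nonneg (by positivity) (cutWeight_nonneg hn x)

lemma sobWeight_neg (n x : ℝ) : sobWeight n (-x) = sobWeight n x := by
  rw [sobWeight, sobWeight, cutWeight_neg, Even.neg_pow (by decide)]

lemma pow_eight_mono {x y : ℝ} (h : |x| ≤ |y|) : x ^ 8 ≤ y ^ 8 := by
  have := pow_le_pow_left₀ (abs_nonneg x) h 8
  rwa [← abs_pow, ← abs_pow, abs_of_nonneg (by positivity), abs_of_nonneg (by positivity)] at this

lemma sobWeight_mono {n : ℝ} (hn : 0 < n) {x y : ℝ} (h : |x| ≤ |y|) :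
    sobWeight n x ≤ sobWeight n y :=
  mul_le_mul (pow_eight_mono h) (cutWeight_mono hn h) (cutWeight_nonneg hn x) (by positivity)

/-- The increments of the concave weight are controlled by its slope at the smaller point. -/
lemma mul_cutWeight_sub_le {n : ℝ} (hn : 0 < n) {x y z : ℝ} (h : |x| ≤ |y|)
    (hz : |y| ≤ |x| + |z|) :
    |x| * (cutWeight n y - cutWeight n x) ≤ |z| * cutWeight n x := by
  have h0 := cutWeight_nonneg hn x
  rcases le_total (|x| / n) 1 with h1 | h1
  · have hx : cutWeight n x = |x| / n := min_eq_right h1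
    have hy : cutWeight n y ≤ |y| / n := min_le_right _ _
    calc |x| * (cutWeight n y - cutWeight n x) ≤ |x| * (|y| / n - |x| / n) := by
          rw [hx]; gcongr
      _ ≤ |x| * ((|x| + |z|) / n - |x| / n) := by gcongr
      _ = |z| * cutWeight n x := by rw [hx]; ring
  · have hx : cutWeight n x = 1 := min_eq_left h1
    have hy := cutWeight_le_one n y
    rw [hx] at h0 ⊢
    nlinarith [abs_nonneg x, abs_nonneg z]

/-- The factorisation has nine terms, each at most `2 ^ 8 * |x| ^ 8`; hence `2304 = 9 * 256`. -/
lemma abs_pow_nine_sub_le {x y : ℝ} (h : |x| ≤ |y|) (h2 : |y| ≤ 2 * |x|) :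
    |y ^ 9 - x ^ 9| ≤ 2304 * |y - x| * x ^ 8 := by
  have e : y ^ 9 - x ^ 9 = (y - x) * ∑ i ∈ Finset.range 9, y ^ i * x ^ (8 - i) := by
    simp [Finset.sum_range_succ]; ring
  have hb : |∑ i ∈ Finset.range 9, y ^ i * x ^ (8 - i)| ≤ 2304 * x ^ 8 := by
    calc |∑ i ∈ Finset.range 9, y ^ i * x ^ (8 - i)|
        ≤ ∑ i ∈ Finset.range 9, |y ^ i * x ^ (8 - i)| := Finset.abs_sum_le_sum_abs _ _
      _ ≤ ∑ i ∈ Finset.range 9, 256 * |x| ^ 8 := by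
          refine Finset.sum_le_sum fun i hi => ?_
          have hi : i ≤ 8 := by simp at hi; omega
          rw [abs_mul, abs_pow, abs_pow]
          calc |y| ^ i * |x| ^ (8 - i) ≤ (2 * |x|) ^ i * (2 * |x|) ^ (8 - i) := by
                gcongr
                linarith [abs_nonneg x]
            _ = 256 * |x| ^ 8 := by rw [← pow_add, Nat.add_sub_cancel' hi]; ring
      _ = 2304 * x ^ 8 := by
          rw [← abs_pow, abs_of_nonneg (by positivity : 0 ≤ x ^ 8)]; simp; ring
  rw [e, abs_mul]
  nlinarith [abs_nonneg (y - x)]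

/-- The two large frequencies are nearly opposite and `s ↦ s * sobWeight n s` is odd, so their terms
form an increment of this function over a step of length `|x|`. The increment costs `|x|` times the
weight and no factor of the large frequency. -/
lemma abs_weight_sum_le_of_ordered {n : ℝ} (hn : 0 < n) {x y z : ℝ} (h : x + y + z = 0)
    (hxy : |x| ≤ |y|) (hyz : |y| ≤ |z|) :
    |x * sobWeight n x + y * sobWeight n y + z * sobWeight n z| ≤
      4610 * (|x| * (√(sobWeight n y) * √(sobWeight n z))) := by
  have hW : sobWeight n y ≤ √(sobWeight n y) * √(sobWeight n z) := by
    calc sobWeight n y = √(sobWeight n y) * √(sobWeight n y) :=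
          (Real.mul_self_sqrt (sobWeight_nonneg hn y)).symm
      _ ≤ _ := by
          gcongr
          exact sobWeight_mono hn hyz
  have key : |x * sobWeight n x + y * sobWeight n y + z * sobWeight n z| ≤
      4610 * (|x| * sobWeight n y) := by
    have hz : z = -(y + x) := by linarith
    set v := y + x with hv
    have hvz : |v| = |z| := by rw [hz, abs_neg]
    have hyv : |y| ≤ |v| := by rw [hvz]; exact hyz
    have hv1 : |v| ≤ |y| + |x| := abs_add_le y x
    have hv2 : |v| ≤ 2 * |y| := by linarith
    rw [hz, sobWeight_neg]
    -- The increment is split into that of the ninth power and that of the cutoff. The three pieces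
    -- contribute `1 + 4608 + 1 = 4610`.
    have e : x * sobWeight n x + y * sobWeight n y + -v * sobWeight n v =
        x * sobWeight n x - (v ^ 9 - y ^ 9) * cutWeight n v
          - y ^ 8 * (y * (cutWeight n v - cutWeight n y)) := by
      unfold sobWeight; ring
    have hm := cutWeight_mono hn hyv
    have h0 := cutWeight_nonneg hn y
    have hc := mul_cutWeight_sub_le hn hyv hv1
    have hc2 : cutWeight n v ≤ 2 * cutWeight n y := by
      rcases eq_or_lt_of_le (abs_nonneg y) with hy | hy
      · have : |v| = |y| := by linarith
        have : cutWeight n v = cutWeight n y := by simp [cutWeight, this]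
        linarith
      · have : |y| * cutWeight n v ≤ |y| * (2 * cutWeight n y) := by nlinarith
        exact le_of_mul_le_mul_left this hy
    have t1 : |x * sobWeight n x| ≤ |x| * sobWeight n y := by
      rw [abs_mul, abs_of_nonneg (sobWeight_nonneg hn x)]
      gcongr
      exact sobWeight_mono hn hxy
    have t2 : |(v ^ 9 - y ^ 9) * cutWeight n v| ≤ 4608 * (|x| * sobWeight n y) := by
      have := abs_pow_nine_sub_le hyv hv2
      rw [hv, add_sub_cancel_left, ← hv] at this
      rw [abs_mul, abs_of_nonneg (cutWeight_nonneg hn v)]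
      calc |v ^ 9 - y ^ 9| * cutWeight n v ≤ (2304 * |x| * y ^ 8) * (2 * cutWeight n y) := by
            gcongr
            exact cutWeight_nonneg hn v
        _ = 4608 * (|x| * sobWeight n y) := by unfold sobWeight; ring
    have t3 : |y ^ 8 * (y * (cutWeight n v - cutWeight n y))| ≤ |x| * sobWeight n y := by
      rw [abs_mul, abs_mul, abs_of_nonneg (by positivity : 0 ≤ y ^ 8),
        abs_of_nonneg (sub_nonneg.2 hm)]
      calc y ^ 8 * (|y| * (cutWeight n v - cutWeight n y)) ≤ y ^ 8 * (|x| * cutWeight n y) := by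
            gcongr
        _ = |x| * sobWeight n y := by unfold sobWeight; ring
    rw [e]
    calc _ ≤ |x * sobWeight n x| + |(v ^ 9 - y ^ 9) * cutWeight n v|
          + |y ^ 8 * (y * (cutWeight n v - cutWeight n y))| :=
          (abs_sub _ _).trans (by gcongr; exact abs_sub _ _)
      _ ≤ _ := by linarith
  exact key.trans (by gcongr)

lemma abs_weight_sum_le {n : ℝ} (hn : 0 < n) {x y z : ℝ} (h : x + y + z = 0) :
    |x * sobWeight n x + y * sobWeight n y + z * sobWeight n z| ≤
      4610 * (|x| * (√(sobWeight n y) * √(sobWeight n z))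
        + |y| * (√(sobWeight n x) * √(sobWeight n z))
        + |z| * (√(sobWeight n x) * √(sobWeight n y))) := by
  set rx := √(sobWeight n x)
  set ry := √(sobWeight n y)
  set rz := √(sobWeight n z)
  have hx : 0 ≤ |x| * (ry * rz) := by positivity
  have hy : 0 ≤ |y| * (rx * rz) := by positivity
  have hz : 0 ≤ |z| * (rx * ry) := by positivity
  have fin {s b : ℝ} (hs : |s| ≤ 4610 * b)
      (e : x * sobWeight n x + y * sobWeight n y + z * sobWeight n z = s)
      (hb : b ≤ |x| * (ry * rz) + |y| * (rx * rz) + |z| * (rx * ry)) :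
      |x * sobWeight n x + y * sobWeight n y + z * sobWeight n z| ≤
        4610 * (|x| * (ry * rz) + |y| * (rx * rz) + |z| * (rx * ry)) := by
    rw [e]; linarith
  rcases le_total |x| |y| with h1 | h1 <;> rcases le_total |y| |z| with h2 | h2
  · exact fin (abs_weight_sum_le_of_ordered hn h h1 h2) rfl (by linarith)
  · rcases le_total |x| |z| with h3 | h3
    · exact fin (abs_weight_sum_le_of_ordered hn (by linarith : x + z + y = 0) h3 h2)
        (by ring) (by rw [mul_comm √(sobWeight n z)]; linarith)
    · exact fin (abs_weight_sum_le_of_ordered hn (by linarith : z + x + y = 0) h3 h1)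
        (by ring) (by linarith)
  · rcases le_total |x| |z| with h3 | h3
    · exact fin (abs_weight_sum_le_of_ordered hn (by linarith : y + x + z = 0) h1 h3)
        (by ring) (by linarith)
    · exact fin (abs_weight_sum_le_of_ordered hn (by linarith : y + z + x = 0) h2 h3)
        (by ring) (by rw [mul_comm √(sobWeight n z)]; linarith)
  · exact fin (abs_weight_sum_le_of_ordered hn (by linarith : z + y + x = 0) h2 h1)
      (by ring) (by rw [mul_comm √(sobWeight n y)]; linarith)

/-! ### Cubic forms over frequencies with sum zero -/

/-- A convolution sum is symmetric in its two finitely supported factors. -/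
lemma sum_mul_sub_comm {R : Type*} [NormedField R] {S : Finset ℤ} {g h : ℤ → R}
    (hg : ∀ k ∉ S, g k = 0) (hh : ∀ k ∉ S, h k = 0) (c : ℤ) :
    ∑ j ∈ S, g j * h (c - j) = ∑ j ∈ S, h j * g (c - j) := by
  -- The reflection `j ↦ c - j` need not preserve `S`, but it preserves `ℤ`; the supports allow
  -- passing to sums over `ℤ`.
  have e1 : ∑' j, g j * h (c - j) = ∑ j ∈ S, g j * h (c - j) :=
    tsum_eq_sum fun j hj => by simp [hg j hj]
  have e2 : ∑' j, h j * g (c - j) = ∑ j ∈ S, h j * g (c - j) :=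
    tsum_eq_sum fun j hj => by simp [hh j hj]
  rw [← e1, ← e2, ← (Equiv.subLeft c).tsum_eq]
  simp [mul_comm]

/-- The trilinear form `∑ f m * g j * h (-m-j)`. -/
def trilinear {R : Type*} [Mul R] [AddCommMonoid R] (S : Finset ℤ) (f g h : ℤ → R) : R :=
  ∑ m ∈ S, ∑ j ∈ S, f m * g j * h (-m - j)

lemma trilinear_swap {R : Type*} [NormedField R] (S : Finset ℤ) (f g h : ℤ → R) :
    trilinear S f g h = trilinear S g f h := by
  unfold trilinear
  rw [Finset.sum_comm]
  refine Finset.sum_congr rfl fun j _ => Finset.sum_congr rfl fun m _ => ?_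
  rw [mul_comm (f m), show -m - j = -j - m by ring]

lemma trilinear_rotate {R : Type*} [NormedField R] {S : Finset ℤ} (f : ℤ → R) {g h : ℤ → R}
    (hg : ∀ k ∉ S, g k = 0) (hh : ∀ k ∉ S, h k = 0) :
    trilinear S f g h = trilinear S f h g := by
  unfold trilinear
  refine Finset.sum_congr rfl fun m _ => ?_
  simp_rw [mul_assoc, ← Finset.mul_sum, sum_mul_sub_comm hg hh]

/-- The multiplier may sit on any of the three factors without changing the form. Adding the three
positions exposes the cancellation hidden in `m + j + (-m - j) = 0`. -/
lemma three_mul_trilinear {R : Type*} [NormedField R] {S : Finset ℤ} {f a : ℤ → R}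
    (ha : ∀ k ∉ S, a k = 0) :
    3 * trilinear S (fun k => f k * a k) a a =
      ∑ m ∈ S, ∑ j ∈ S, (f m + f j + f (-m - j)) * (a m * a j * a (-m - j)) := by
  have hf : ∀ k ∉ S, f k * a k = 0 := fun k hk => by simp [ha k hk]
  have e1 := trilinear_swap S (fun k => f k * a k) a a
  have e2 := trilinear_rotate a hf ha
  have : 3 * trilinear S (fun k => f k * a k) a a = trilinear S (fun k => f k * a k) a a
      + trilinear S a (fun k => f k * a k) a + trilinear S a a (fun k => f k * a k) := by
    rw [← e2, ← e1]; ring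
  rw [this]
  simp only [trilinear, ← Finset.sum_add_distrib]
  refine Finset.sum_congr rfl fun j _ => Finset.sum_congr rfl fun m _ => ?_
  ring

lemma sum_shift_le {S : Finset ℤ} {ρ : ℤ → ℝ} (hρ : ∀ k ∉ S, ρ k = 0) (h0 : ∀ k, 0 ≤ ρ k)
    (c : ℤ) : ∑ j ∈ S, ρ (c - j) ≤ ∑ j ∈ S, ρ j := by
  have := sum_mul_sub_comm (S := S) (g := fun k => if k ∈ S then (1 : ℝ) else 0) (h := ρ)
    (by simp +contextual) hρ c
  calc ∑ j ∈ S, ρ (c - j) = ∑ j ∈ S, (if j ∈ S then (1 : ℝ) else 0) * ρ (c - j) :=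
        Finset.sum_congr rfl fun j hj => by simp [hj]
    _ = _ := this
    _ ≤ _ := Finset.sum_le_sum fun j _ => by split_ifs <;> simp [h0 j]

/-- Young's inequality for `ℓ¹`, `ℓ²`, `ℓ²`. -/
lemma trilinear_le {S : Finset ℤ} {f ρ : ℤ → ℝ} (hρ : ∀ k ∉ S, ρ k = 0) (hf : ∀ k, 0 ≤ f k) :
    trilinear S f ρ ρ ≤ (∑ k ∈ S, f k) * ∑ k ∈ S, ρ k ^ 2 := by
  unfold trilinear
  rw [Finset.sum_mul]
  refine Finset.sum_le_sum fun m _ => ?_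
  simp_rw [mul_assoc, ← Finset.mul_sum]
  refine mul_le_mul_of_nonneg_left ?_ (hf m)
  have h1 := sum_shift_le (S := S) (ρ := fun k => ρ k ^ 2) (fun k hk => by simp [hρ k hk])
    (fun k => sq_nonneg _) (-m)
  calc ∑ j ∈ S, ρ j * ρ (-m - j) ≤ ∑ j ∈ S, (ρ j ^ 2 + ρ (-m - j) ^ 2) / 2 :=
        Finset.sum_le_sum fun j _ => by nlinarith [sq_nonneg (ρ j - ρ (-m - j))]
    _ ≤ ∑ k ∈ S, ρ k ^ 2 := by rw [← Finset.sum_div, Finset.sum_add_distrib]; linarith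

/-- The cubic form of the weighted energy loses no derivative. -/
lemma norm_trilinear_weight_le {n : ℝ} (hn : 0 < n) {S : Finset ℤ} {a : ℤ → ℂ}
    (ha : ∀ k ∉ S, a k = 0) :
    ‖trilinear S (fun k : ℤ => (((k : ℝ) * sobWeight n k : ℝ) : ℂ) * a k) a a‖ ≤
      4610 * (∑ k ∈ S, |(k : ℝ)| * ‖a k‖) * ∑ k ∈ S, sobWeight n k * ‖a k‖ ^ 2 := by
  set v : ℤ → ℝ := fun k => |(k : ℝ)| * ‖a k‖ with hv
  set ρ : ℤ → ℝ := fun k => √(sobWeight n k) * ‖a k‖ with hρ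
  have hv0 : ∀ k ∉ S, v k = 0 := fun k hk => by simp [hv, ha k hk]
  have hρ0 : ∀ k ∉ S, ρ k = 0 := fun k hk => by simp [hρ, ha k hk]
  have hρ2 : ∀ k, ρ k ^ 2 = sobWeight n k * ‖a k‖ ^ 2 := fun k => by
    simp only [hρ, mul_pow, Real.sq_sqrt (sobWeight_nonneg hn _)]
  -- The factor 3 lets both sides be symmetrised: the multiplier on the left, the position of `|k|`
  -- on the right. The symbol bound then applies term by term.
  have h3 : 3 * ‖trilinear S (fun k : ℤ => (((k : ℝ) * sobWeight n k : ℝ) : ℂ) * a k) a a‖ ≤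
      3 * (4610 * trilinear S v ρ ρ) := by
    have e : 3 * trilinear S v ρ ρ =
        trilinear S v ρ ρ + trilinear S ρ v ρ + trilinear S ρ ρ v := by
      rw [← trilinear_rotate ρ hv0 hρ0, ← trilinear_swap S v ρ ρ]; ring
    have e' : 3 * (4610 * trilinear S v ρ ρ) = 4610 * (3 * trilinear S v ρ ρ) := by ring
    rw [e', e, show (3 : ℝ) = ‖(3 : ℂ)‖ by simp, ← norm_mul, three_mul_trilinear ha]
    simp only [trilinear, ← Finset.sum_add_distrib]
    rw [Finset.mul_sum]
    refine (norm_sum_le _ _).trans (Finset.sum_le_sum fun m _ => ?_)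
    rw [Finset.mul_sum]
    refine (norm_sum_le _ _).trans (Finset.sum_le_sum fun j _ => ?_)
    have := abs_weight_sum_le hn (x := m) (y := j) (z := ((-m - j : ℤ) : ℝ)) (by push_cast; ring)
    rw [norm_mul, norm_mul, norm_mul, ← Complex.ofReal_add, ← Complex.ofReal_add,
      Complex.norm_real, Real.norm_eq_abs]
    refine (mul_le_mul_of_nonneg_right this (by positivity)).trans_eq ?_
    simp only [hv, hρ]; ring
  have h4 := trilinear_le (S := S) hρ0 (f := v) fun k => by positivity
  simp_rw [hρ2] at h4
  nlinarith

/-! ### Energy identities for the truncated flow -/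

/-- The Fourier side of `-Λ⁻¹ u - u u_α`. -/
noncomputable def burgersField (a : ℤ → ℂ) (k : ℤ) : ℂ :=
  -(a k / |(k : ℝ)|) - Complex.I * k / 2 * ∑' j, a j * a (k - j)

/-- By reality `star (a k)` is `a (-k)`, so after `k ↦ -k` the pairing with the quadratic term
becomes the cubic form over frequencies with sum zero. -/
lemma sum_weight_re_burgersField {N : ℕ} {a : ℤ → ℂ} {W : ℝ → ℝ} (hW : ∀ x, W (-x) = W x)
    (ha : ∀ k ∉ Finset.Icc (-N : ℤ) N, a k = 0) (hc : ∀ k, a (-k) = star (a k)) :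
    ∑ k ∈ Finset.Icc (-N : ℤ) N, W k * (2 * (star (a k) * burgersField a k).re) =
      -2 * ∑ k ∈ Finset.Icc (-N : ℤ) N, W k * (‖a k‖ ^ 2 / |(k : ℝ)|) +
      (Complex.I * trilinear (Finset.Icc (-N : ℤ) N)
        (fun k : ℤ => (((k : ℝ) * W k : ℝ) : ℂ) * a k) a a).re := by
  set S := Finset.Icc (-N : ℤ) N with hS
  have hneg : trilinear S (fun k : ℤ => (((k : ℝ) * W k : ℝ) : ℂ) * a k) a a =
      ∑ k ∈ S, ∑ j ∈ S, (((-k : ℝ) * W k : ℝ) : ℂ) * star (a k) * a j * a (k - j) := by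
    unfold trilinear
    refine Finset.sum_equiv (Equiv.neg ℤ) (fun k => by simp [hS]; omega) fun k _ => ?_
    refine Finset.sum_congr rfl fun j _ => ?_
    simp [hW, hc]
  rw [hneg, Finset.mul_sum, Finset.mul_sum, Complex.re_sum, ← Finset.sum_add_distrib]
  refine Finset.sum_congr rfl fun k _ => ?_
  rw [burgersField, tsum_eq_sum (s := S) fun j hj => by simp [ha j hj]]
  have e : ∑ j ∈ S, (((-k : ℝ) * W k : ℝ) : ℂ) * star (a k) * a j * a (k - j) =
      (((-k : ℝ) * W k : ℝ) : ℂ) * (star (a k) * ∑ j ∈ S, a j * a (k - j)) := by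
    rw [Finset.mul_sum, Finset.mul_sum]
    refine Finset.sum_congr rfl fun j _ => by ring
  rw [e]
  have e2 : star (a k) * (-(a k / |(k : ℝ)|) - Complex.I * k / 2 * ∑ j ∈ S, a j * a (k - j)) =
      ((-(‖a k‖ ^ 2 / |(k : ℝ)|) : ℝ) : ℂ) +
        ((k / 2 : ℝ) : ℂ) * (-Complex.I * (star (a k) * ∑ j ∈ S, a j * a (k - j))) := by
    have : star (a k) * a k = ((‖a k‖ ^ 2 : ℝ) : ℂ) := by
      rw [Complex.star_def, mul_comm, Complex.mul_conj, Complex.normSq_eq_norm_sq]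
    push_cast at this ⊢
    linear_combination (-1 / ((|(k : ℝ)| : ℝ) : ℂ)) * this
  rw [e2]
  set z := star (a k) * ∑ j ∈ S, a j * a (k - j)
  simp only [Complex.add_re, Complex.ofReal_re, Complex.ofReal_im, Complex.mul_re,
    Complex.neg_re, Complex.I_re, Complex.I_im, Complex.neg_im, Complex.im_ofReal_mul]
  ring

/-- For weight 1 the symmetrised multiplier is `m + j + (-m - j) = 0`: the nonlinearity conserves
the `L²` norm. -/
lemma sum_re_burgersField {N : ℕ} {a : ℤ → ℂ}
    (ha : ∀ k ∉ Finset.Icc (-N : ℤ) N, a k = 0) (hc : ∀ k, a (-k) = star (a k)) :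
    ∑ k ∈ Finset.Icc (-N : ℤ) N, 2 * (star (a k) * burgersField a k).re =
      -2 * ∑ k ∈ Finset.Icc (-N : ℤ) N, ‖a k‖ ^ 2 / |(k : ℝ)| := by
  have h := sum_weight_re_burgersField (W := fun _ => 1) (fun _ => rfl) ha hc
  have h3 := three_mul_trilinear (f := fun k : ℤ => (k : ℂ)) ha
  have : trilinear (Finset.Icc (-N : ℤ) N) (fun k : ℤ => (k : ℂ) * a k) a a = 0 := by
    simpa using h3
  simpa [this] using h

/-- The dissipative term has a favourable sign and is discarded. -/
lemma sum_sobWeight_re_burgersField_le {n : ℝ} (hn : 0 < n) {N : ℕ} {a : ℤ → ℂ}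
    (ha : ∀ k ∉ Finset.Icc (-N : ℤ) N, a k = 0) (hc : ∀ k, a (-k) = star (a k)) :
    ∑ k ∈ Finset.Icc (-N : ℤ) N, sobWeight n k * (2 * (star (a k) * burgersField a k).re) ≤
      4610 * (∑ k ∈ Finset.Icc (-N : ℤ) N, |(k : ℝ)| * ‖a k‖)
        * ∑ k ∈ Finset.Icc (-N : ℤ) N, sobWeight n k * ‖a k‖ ^ 2 := by
  rw [sum_weight_re_burgersField (sobWeight_neg n) ha hc]
  have h1 : 0 ≤ ∑ k ∈ Finset.Icc (-N : ℤ) N, sobWeight n k * (‖a k‖ ^ 2 / |(k : ℝ)|) :=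
    Finset.sum_nonneg fun k _ => mul_nonneg (sobWeight_nonneg hn _) (by positivity)
  have h2 := (Complex.re_le_norm _).trans_eq (norm_mul Complex.I (trilinear (Finset.Icc (-N : ℤ) N)
    (fun k : ℤ => (((k : ℝ) * sobWeight n k : ℝ) : ℂ) * a k) a a))
  rw [Complex.norm_I, one_mul] at h2
  linarith [norm_trilinear_weight_le hn ha]

/-! ### Interpolation inequalities -/

/-- Cauchy–Schwarz twice: first `|k| = |k|⁻¹ * k ^ 2` off `k = 0`, then `k ^ 4` is distributed as `1
* k ^ 4` between `Y` and `M`. -/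
lemma sum_abs_mul_norm_le {N : ℕ} {a : ℤ → ℂ} {Y M : ℝ}
    (hY : ∑ k ∈ Finset.Icc (-N : ℤ) N, ‖a k‖ ^ 2 ≤ Y)
    (hM : ∑ k ∈ Finset.Icc (-N : ℤ) N, sobWeight 1 k * ‖a k‖ ^ 2 ≤ M) :
    ∑ k ∈ Finset.Icc (-N : ℤ) N, |(k : ℝ)| * ‖a k‖ ≤
      √(∑' k : ℤ, 1 / (k : ℝ) ^ 2) * √√(Y * M) := by
  set S := Finset.Icc (-N : ℤ) N
  have hsum : Summable fun k : ℤ => 1 / (k : ℝ) ^ 2 := by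
    simpa using Real.summable_one_div_int_pow.2 (by norm_num : 1 < 2)
  have hW : ∀ k : ℤ, sobWeight 1 k = (k : ℝ) ^ 8 := fun k => by
    rcases eq_or_ne k 0 with rfl | hk
    · simp [sobWeight]
    · have : (1 : ℝ) ≤ |(k : ℝ)| := by exact_mod_cast Int.one_le_abs hk
      simp [sobWeight, cutWeight, this]
  have h4 : ∑ k ∈ S, ((k : ℝ) ^ 2 * ‖a k‖) ^ 2 ≤ √(Y * M) := by
    apply Real.le_sqrt_of_sq_le
    calc (∑ k ∈ S, ((k : ℝ) ^ 2 * ‖a k‖) ^ 2) ^ 2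
        = (∑ k ∈ S, ‖a k‖ * ((k : ℝ) ^ 4 * ‖a k‖)) ^ 2 := by
          congr 1; refine Finset.sum_congr rfl fun k _ => by ring
      _ ≤ (∑ k ∈ S, ‖a k‖ ^ 2) * ∑ k ∈ S, ((k : ℝ) ^ 4 * ‖a k‖) ^ 2 :=
          Finset.sum_mul_sq_le_sq_mul_sq _ _ _
      _ ≤ Y * M := by
          have : ∑ k ∈ S, ((k : ℝ) ^ 4 * ‖a k‖) ^ 2 = ∑ k ∈ S, sobWeight 1 k * ‖a k‖ ^ 2 := by
            refine Finset.sum_congr rfl fun k _ => by rw [hW]; ring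
          rw [this]
          refine mul_le_mul hY hM ?_ ((Finset.sum_nonneg fun _ _ => by positivity).trans hY)
          exact Finset.sum_nonneg fun k _ => mul_nonneg (sobWeight_nonneg one_pos _) (by positivity)
  rw [← Real.sqrt_mul' _ (Real.sqrt_nonneg _)]
  apply Real.le_sqrt_of_sq_le
  calc (∑ k ∈ S, |(k : ℝ)| * ‖a k‖) ^ 2
      = (∑ k ∈ S, 1 / |(k : ℝ)| * ((k : ℝ) ^ 2 * ‖a k‖)) ^ 2 := by
        congr 1
        refine Finset.sum_congr rfl fun k _ => ?_
        rcases eq_or_ne k 0 with rfl | hk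
        · simp
        · have : |(k : ℝ)| ≠ 0 := by simpa using hk
          rw [← sq_abs (k : ℝ)]; field_simp
    _ ≤ (∑ k ∈ S, (1 / |(k : ℝ)|) ^ 2) * ∑ k ∈ S, ((k : ℝ) ^ 2 * ‖a k‖) ^ 2 :=
        Finset.sum_mul_sq_le_sq_mul_sq _ _ _
    _ ≤ _ := by
        gcongr
        · simp_rw [div_pow, sq_abs, one_pow]
          exact hsum.sum_le_tsum _ fun k _ => by positivity

/-- Frequencies below `R` are absorbed by the dissipation, those above by the eighth-order energy.
-/
lemma norm_sq_le_interpolation {x R : ℝ} (k : ℤ) (hk : k = 0 → x = 0) (hx : 0 ≤ x) (hR : 0 < R) :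
    x ≤ R * (x / |(k : ℝ)|) + sobWeight 1 k * x / R ^ 8 := by
  rcases eq_or_ne k 0 with rfl | h0
  · simp [hk rfl, sobWeight]
  have h1 : (1 : ℝ) ≤ |(k : ℝ)| := by exact_mod_cast Int.one_le_abs h0
  have hW : sobWeight 1 k = |(k : ℝ)| ^ 8 := by
    simp [sobWeight, cutWeight, h1, ← abs_pow, abs_of_nonneg (by positivity : 0 ≤ (k : ℝ) ^ 8)]
  rw [hW]
  have hp : 0 < |(k : ℝ)| := by linarith
  rcases le_total |(k : ℝ)| R with h | h
  · have : x ≤ R * (x / |(k : ℝ)|) := by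
      rw [← mul_div_assoc, le_div_iff₀ hp]; nlinarith
    have : 0 ≤ |(k : ℝ)| ^ 8 * x / R ^ 8 := by positivity
    linarith
  · have : x ≤ |(k : ℝ)| ^ 8 * x / R ^ 8 := by
      rw [le_div_iff₀ (by positivity), mul_comm]
      gcongr
    have : 0 ≤ R * (x / |(k : ℝ)|) := by positivity
    linarith

/-! ### The differential inequalities for the two energies -/

lemma hasDerivAt_rpow_eighth {f : ℝ → ℝ} {f' t : ℝ} (hf : HasDerivAt f f' t) (h : 0 < f t) :
    HasDerivAt (fun s => f s ^ (1 / 8 : ℝ)) (f' / 8 * (f t ^ (1 / 8 : ℝ) / f t)) t := by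
  convert hf.rpow_const (p := 1 / 8) (Or.inl h.ne') using 1
  rw [Real.rpow_sub_one h.ne']; ring

/-- Smallness of `M` and decay of `Y` from a dissipation `H` that controls `Y` only by
interpolation with `M`. -/
theorem energy_decay {T K Q : ℝ} (hK : 0 ≤ K) (hQ : 0 < Q) (hKQ : 12 * K * Q ^ 4 ≤ 1)
    {Y M H M' : ℝ → ℝ} (hY : ∀ t ∈ Set.Icc 0 T, 0 < Y t) (hM : ∀ t ∈ Set.Icc 0 T, 0 < M t)
    (dY : ∀ t ∈ Set.Icc 0 T, HasDerivAt Y (-2 * H t) t)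
    (dM : ∀ t ∈ Set.Icc 0 T, HasDerivAt M (M' t) t)
    (hM' : ∀ t ∈ Set.Icc 0 T, M' t ≤ K * √√(Y t * M t) * M t)
    (hH : ∀ t ∈ Set.Icc 0 T, ∀ R : ℝ, 0 < R → Y t ≤ R * H t + M t / R ^ 8)
    (Y0 : Y 0 ≤ Q ^ 8) (M0 : M 0 ≤ Q ^ 8) {t : ℝ} (ht : t ∈ Set.Icc 0 T) :
    M t ≤ (2 * Q) ^ 8 ∧ Y t ≤ (32 * Q / (1 + t)) ^ 8 := by
  set p : ℝ → ℝ := fun s => Y s ^ (1 / 8 : ℝ) with hp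
  set q : ℝ → ℝ := fun s => M s ^ (1 / 8 : ℝ) with hq
  have p0 : ∀ s ∈ Set.Icc 0 T, 0 < p s := fun s hs => Real.rpow_pos_of_pos (hY s hs) _
  have q0 : ∀ s ∈ Set.Icc 0 T, 0 < q s := fun s hs => Real.rpow_pos_of_pos (hM s hs) _
  have p8 : ∀ s ∈ Set.Icc 0 T, p s ^ 8 = Y s := fun s hs => by
    rw [hp, ← Real.rpow_natCast, ← Real.rpow_mul (hY s hs).le]; norm_num
  have q8 : ∀ s ∈ Set.Icc 0 T, q s ^ 8 = M s := fun s hs => by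
    rw [hq, ← Real.rpow_natCast, ← Real.rpow_mul (hM s hs).le]; norm_num
  have dp : ∀ s ∈ Set.Icc 0 T, ∃ p', HasDerivAt p p' s ∧ p' ≤ -(p s ^ 2 / q s) / 16 := by
    intro s hs
    refine ⟨_, hasDerivAt_rpow_eighth (dY s hs) (hY s hs), ?_⟩
    have a := p0 s hs
    have b := q0 s hs
    -- This `R` makes the high-frequency term equal to `Y / 256`, which is absorbed on the left.
    have h1 := hH s hs (2 * q s / p s) (by positivity)
    have e : M s / (2 * q s / p s) ^ 8 = Y s / 256 := by
      rw [← q8 s hs, ← p8 s hs]; field_simp; norm_num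
    rw [e] at h1
    have h2 : Y s * (p s / (4 * q s)) ≤ H s := by
      have : Y s / 2 ≤ 2 * q s / p s * H s := by linarith [hY s hs]
      calc Y s * (p s / (4 * q s)) = (Y s / 2) * (p s / (2 * q s)) := by field_simp; norm_num
        _ ≤ (2 * q s / p s * H s) * (p s / (2 * q s)) := by gcongr
        _ = H s := by field_simp
    change -2 * H s / 8 * (p s / Y s) ≤ _
    have hYs := hY s hs
    calc -2 * H s / 8 * (p s / Y s) ≤ -2 * (Y s * (p s / (4 * q s))) / 8 * (p s / Y s) := by
          have : 0 ≤ p s / Y s := by positivity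
          nlinarith
      _ = _ := by field_simp; norm_num
  have dq : ∀ s ∈ Set.Icc 0 T, ∃ q', HasDerivAt q q' s ∧ q' ≤ K / 8 * (p s ^ 2 * q s ^ 3) := by
    intro s hs
    refine ⟨_, hasDerivAt_rpow_eighth (dM s hs) (hM s hs), ?_⟩
    have a := p0 s hs
    have b := q0 s hs
    have hMs := hM s hs
    have e : √√(Y s * M s) = p s ^ 2 * q s ^ 2 := by
      rw [← p8 s hs, ← q8 s hs, show p s ^ 8 * q s ^ 8 = ((p s ^ 2 * q s ^ 2) ^ 2) ^ 2 by ring,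
        Real.sqrt_sq (by positivity), Real.sqrt_sq (by positivity)]
    have h1 := hM' s hs
    rw [e] at h1
    change M' s / 8 * (q s / M s) ≤ _
    calc M' s / 8 * (q s / M s) ≤ K * (p s ^ 2 * q s ^ 2) * M s / 8 * (q s / M s) := by gcongr
      _ = _ := by field_simp
  choose! p' hp' hple using dp
  choose! q' hq' hqle using dq
  have h0t : (0 : ℝ) ∈ Set.Icc 0 T := ⟨le_rfl, ht.1.trans ht.2⟩
  have pQ : p 0 ≤ Q := by
    refine le_of_pow_le_pow_left₀ (n := 8) (by norm_num) hQ.le ?_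
    rw [p8 0 h0t]; exact Y0
  have qQ : q 0 ≤ Q := by
    refine le_of_pow_le_pow_left₀ (n := 8) (by norm_num) hQ.le ?_
    rw [q8 0 h0t]; exact M0
  -- The derivative of `q⁻³` is at least `-(3 K / 8) p² / q`, and that of `-6 K p` is at least `(3 K
  -- / 8) p² / q`; the coefficient 6 makes them cancel.
  have dF : ∀ s ∈ Set.Icc 0 T, HasDerivAt (fun s => (q s ^ 3)⁻¹ - 6 * K * p s)
      (-(3 * q s ^ 2 * q' s) / (q s ^ 3) ^ 2 - 6 * K * p' s) s := fun s hs => by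
    have := (((hq' s hs).pow 3).inv (pow_ne_zero _ (q0 s hs).ne')).sub ((hp' s hs).const_mul (6 * K))
    exact this.congr_deriv (by simp)
  have mono : MonotoneOn (fun s => (q s ^ 3)⁻¹ - 6 * K * p s) (Set.Icc 0 T) := by
    refine monotoneOn_of_deriv_nonneg (convex_Icc 0 T)
      (fun s hs => (dF s hs).continuousAt.continuousWithinAt)
      (fun s hs => (dF s (interior_subset hs)).differentiableAt.differentiableWithinAt)
      fun s hs => ?_
    have hs := interior_subset hs
    rw [(dF s hs).deriv]
    have a := p0 s hs
    have b := q0 s hs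
    have h1 : 3 * q s ^ 2 * q' s / (q s ^ 3) ^ 2 ≤ 3 / 8 * (K * (p s ^ 2 / q s)) := by
      calc 3 * q s ^ 2 * q' s / (q s ^ 3) ^ 2
          ≤ 3 * q s ^ 2 * (K / 8 * (p s ^ 2 * q s ^ 3)) / (q s ^ 3) ^ 2 := by
            gcongr; exact hqle s hs
        _ = _ := by field_simp
    have h2 : 6 * K * p' s ≤ 6 * K * (-(p s ^ 2 / q s) / 16) := by
      gcongr; exact hple s hs
    rw [neg_div]
    linarith
  have qbound : ∀ s ∈ Set.Icc 0 T, q s ≤ 2 * Q := by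
    intro s hs
    have h1 := mono h0t hs hs.1
    have a := p0 s hs
    have b := q0 s hs
    have b0 := q0 0 h0t
    simp only at h1
    have h2 : (Q ^ 3)⁻¹ ≤ (q 0 ^ 3)⁻¹ := by gcongr
    -- Smallness of the data: the correction `6 K p` uses up at most half of `Q⁻³`, and `Q⁻³ / 2 ≥
    -- (2 Q)⁻³`.
    have h3 : 6 * K * p 0 ≤ (Q ^ 3)⁻¹ / 2 := by
      calc 6 * K * p 0 ≤ 6 * K * Q := by gcongr
        _ = (12 * K * Q ^ 4) * ((Q ^ 3)⁻¹ / 2) := by field_simp; ring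
        _ ≤ 1 * ((Q ^ 3)⁻¹ / 2) := by gcongr
        _ = _ := one_mul _
    have h4 : ((2 * Q) ^ 3)⁻¹ ≤ (q s ^ 3)⁻¹ := by
      have : ((2 * Q) ^ 3)⁻¹ ≤ (Q ^ 3)⁻¹ / 2 := by
        rw [mul_pow, mul_inv]; have : 0 < (Q ^ 3)⁻¹ := by positivity
        linarith
      have : 0 ≤ 6 * K * p s := by positivity
      linarith
    exact le_of_pow_le_pow_left₀ (n := 3) (by norm_num) (by positivity)
      ((inv_le_inv₀ (by positivity) (by positivity)).1 h4)
  -- With `q ≤ 2 Q` the inequality for `p` is of Riccati type, `p' ≤ -p² / (32 Q)`, so `1 / p` grows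
  -- at least linearly.
  have dG : ∀ s ∈ Set.Icc 0 T, HasDerivAt (fun s => (p s)⁻¹ - s / (32 * Q))
      (-p' s / p s ^ 2 - 1 / (32 * Q)) s := fun s hs =>
    ((hp' s hs).inv (p0 s hs).ne').sub ((hasDerivAt_id s).div_const _)
  have mono2 : MonotoneOn (fun s => (p s)⁻¹ - s / (32 * Q)) (Set.Icc 0 T) := by
    refine monotoneOn_of_deriv_nonneg (convex_Icc 0 T)
      (fun s hs => (dG s hs).continuousAt.continuousWithinAt)
      (fun s hs => (dG s (interior_subset hs)).differentiableAt.differentiableWithinAt)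
      fun s hs => ?_
    have hs := interior_subset hs
    rw [(dG s hs).deriv]
    have a := p0 s hs
    have b := q0 s hs
    have : 1 / (32 * Q) ≤ -p' s / p s ^ 2 := by
      rw [le_div_iff₀ (by positivity)]
      calc 1 / (32 * Q) * p s ^ 2 = p s ^ 2 / (2 * Q) / 16 := by field_simp; norm_num
        _ ≤ p s ^ 2 / q s / 16 := by gcongr; exact qbound s hs
        _ ≤ -p' s := by linarith [hple s hs]
    linarith
  constructor
  · rw [← q8 t ht]; exact pow_le_pow_left₀ (q0 t ht).le (qbound t ht) 8
  · rw [← p8 t ht]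
    refine pow_le_pow_left₀ (p0 t ht).le ?_ 8
    have h1 := mono2 h0t ht ht.1
    have a := p0 t ht
    have a0 := p0 0 h0t
    simp only [zero_div, sub_zero] at h1
    have h2 : Q⁻¹ ≤ (p 0)⁻¹ := by gcongr
    have h3 : (1 + t) / (32 * Q) ≤ (p t)⁻¹ := by
      have : (1 + t) / (32 * Q) ≤ Q⁻¹ + t / (32 * Q) := by
        rw [add_div]
        gcongr
        rw [one_div, mul_inv]
        have : 0 < Q⁻¹ := by positivity
        linarith
      linarith
    have h1t : 0 < 1 + t := by linarith [ht.1]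
    have := inv_anti₀ (by positivity) h3
    rwa [inv_inv, inv_div] at this

/-! ### Galerkin approximations -/

/-- Such a field is globally Lipschitz and bounded by some `L`, so Picard–Lindelöf on the ball of
radius `L * T` covers the whole interval at once. -/
lemma exists_integralCurve_of_hasCompactSupport {E : Type*} [NormedAddCommGroup E]
    [NormedSpace ℝ E] [FiniteDimensional ℝ E] {v : E → E} (hv : ContDiff ℝ 1 v)
    (hs : HasCompactSupport v) (x₀ : E) {T : ℝ} (hT : 0 < T) :
    ∃ α : ℝ → E, α 0 = x₀ ∧ ∀ t ∈ Set.Ioo (-T) T, HasDerivAt α (v (α t)) t := by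
  have := FiniteDimensional.complete ℝ E
  obtain ⟨K, hK⟩ := hv.lipschitzWith_of_hasCompactSupport hs one_ne_zero
  obtain ⟨L, hL⟩ := hs.exists_bound_of_continuous hv.continuous
  have hL0 : 0 ≤ L := (norm_nonneg _).trans (hL x₀)
  let t₀ : Set.Icc (-T) T := ⟨0, by constructor <;> linarith⟩
  have hpl : IsPicardLindelof (fun _ => v) t₀ x₀ ⟨L * T, by positivity⟩ 0 ⟨L, hL0⟩ K :=
    .of_time_independent (fun x _ => hL x) hK.lipschitzOnWith (by simp [t₀]; exact le_rfl)
  obtain ⟨α, h0, hα⟩ := hpl.exists_eq_forall_mem_Icc_hasDerivWithinAt₀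
  exact ⟨α, h0, fun t ht => (hα t (Set.Ioo_subset_Icc_self ht)).hasDerivAt
    (Icc_mem_nhds ht.1 ht.2)⟩

lemma burgersField_neg {a : ℤ → ℂ} (hc : ∀ k, a (-k) = star (a k)) (k : ℤ) :
    burgersField a (-k) = star (burgersField a k) := by
  have h : ∑' j, a j * a (-k - j) = star (∑' j, a j * a (k - j)) := by
    rw [tsum_star, ← (Equiv.neg ℤ).tsum_eq]
    refine tsum_congr fun j => ?_
    rw [Equiv.neg_apply, hc, show -k - -j = -(k - j) by ring, hc]
    simp
  rw [burgersField, burgersField, h, hc]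
  simp

lemma burgersField_zero {a : ℤ → ℂ} : burgersField a 0 = 0 := by simp [burgersField]

/-- The `k`-th coefficient of the real trigonometric polynomial with positive modes `x`. -/
noncomputable def modeExt (N : ℕ) (k : ℤ) : (Fin N → ℂ) →L[ℝ] ℂ :=
  -- Mode `k` is stored in slot `|k| - 1`. The condition `k ≠ 0` is separate because truncated
  -- subtraction would send mode 0 to slot 0.
  if h : k.natAbs - 1 < N ∧ k ≠ 0 then
    if 0 < k then ContinuousLinearMap.proj ⟨k.natAbs - 1, h.1⟩
    else Complex.conjCLE.toContinuousLinearMap ∘L ContinuousLinearMap.proj ⟨k.natAbs - 1, h.1⟩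
  else 0

lemma modeExt_eq_zero {N : ℕ} {k : ℤ} (hk : k ∉ Finset.Icc (-N : ℤ) N) (x : Fin N → ℂ) :
    modeExt N k x = 0 := by
  have : ¬ (k.natAbs - 1 < N ∧ k ≠ 0) := by
    simp only [Finset.mem_Icc] at hk; omega
  simp [modeExt, this]

lemma modeExt_zero {N : ℕ} (x : Fin N → ℂ) : modeExt N 0 x = 0 := by simp [modeExt]

lemma modeExt_neg {N : ℕ} (k : ℤ) (x : Fin N → ℂ) : modeExt N (-k) x = star (modeExt N k x) := by
  rcases lt_trichotomy k 0 with h | rfl | h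
  · by_cases h1 : k.natAbs - 1 < N
    · simp [modeExt, h1, h.ne, h, h.not_gt]
    · simp [modeExt, h1]
  · simp [modeExt_zero]
  · by_cases h1 : k.natAbs - 1 < N
    · simp [modeExt, h1, h.ne', h, h.not_gt]
    · simp [modeExt, h1]

lemma modeExt_apply {N : ℕ} {f : ℤ → ℂ} (h0 : f 0 = 0) (hf : ∀ k, f (-k) = star (f k)) {k : ℤ}
    (hk : k ∈ Finset.Icc (-N : ℤ) N) : modeExt N k (fun i => f (i + 1)) = f k := by
  have pos : ∀ k : ℤ, 0 < k → k ≤ N → modeExt N k (fun i => f (i + 1)) = f k := by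
    intro k h h2
    have h1 : k.natAbs - 1 < N := by omega
    simp only [modeExt, h1, h.ne', h, ne_eq, not_false_eq_true, and_self, ↓reduceDIte, ↓reduceIte,
      ContinuousLinearMap.proj_apply]
    congr 1
    omega
  rw [Finset.mem_Icc] at hk
  rcases lt_trichotomy k 0 with h | rfl | h
  · have := pos (-k) (by omega) (by omega)
    rw [modeExt_neg, hf] at this
    exact star_injective this
  · rw [modeExt_zero, h0]
  · exact pos k h hk.2

/-- Places energy sublevel sets inside the ball where the cutoff of the vector field equals 1. -/
lemma norm_le_sqrt_modeExt {N : ℕ} (x : Fin N → ℂ) :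
    ‖x‖ ≤ √(∑ k ∈ Finset.Icc (-N : ℤ) N, ‖modeExt N k x‖ ^ 2) := by
  refine (pi_norm_le_iff_of_nonneg (Real.sqrt_nonneg _)).2 fun i => ?_
  apply Real.le_sqrt_of_sq_le
  have hi : modeExt N ((i : ℤ) + 1) x = x i := by
    have h1 : ((i : ℤ) + 1).natAbs - 1 < N := by omega
    have h2 : (0 : ℤ) < (i : ℤ) + 1 := by omega
    simp only [modeExt, h1, h2.ne', h2, ne_eq, not_false_eq_true, and_self, ↓reduceDIte,
      ↓reduceIte, ContinuousLinearMap.proj_apply]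
    congr 1
  rw [← hi]
  exact Finset.single_le_sum (f := fun k => ‖modeExt N k x‖ ^ 2) (fun k _ => by positivity)
    (by simp only [Finset.mem_Icc]; omega)

/-- The Galerkin vector field on the positive modes. -/
noncomputable def galerkinField (N : ℕ) (x : Fin N → ℂ) : Fin N → ℂ :=
  fun i => burgersField (fun k => modeExt N k x) (i + 1)

lemma contDiff_galerkinField (N : ℕ) : ContDiff ℝ 1 (galerkinField N) := by
  rw [contDiff_pi]
  intro i
  have e : (fun x => galerkinField N x i) = fun x : Fin N → ℂ =>
      -(modeExt N (i + 1) x / |(((i : ℤ) + 1 : ℤ) : ℝ)|) -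
        Complex.I * ((i + 1 : ℤ) : ℂ) / 2 *
          ∑ j ∈ Finset.Icc (-N : ℤ) N, modeExt N j x * modeExt N (i + 1 - j) x := by
    funext x
    rw [galerkinField, burgersField, tsum_eq_sum (s := Finset.Icc (-N : ℤ) N)
      fun j hj => by rw [modeExt_eq_zero hj, zero_mul]]
  rw [e]
  simp only [div_eq_mul_inv]
  have h : ∀ k, ContDiff ℝ 1 fun x => modeExt N k x := fun k => (modeExt N k).contDiff
  refine ((h _).mul contDiff_const).neg.sub (contDiff_const.mul ?_)
  exact ContDiff.sum fun j _ => (h _).mul (h _)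

lemma modeExt_galerkinField {N : ℕ} (x : Fin N → ℂ) {k : ℤ} (hk : k ∈ Finset.Icc (-N : ℤ) N) :
    modeExt N k (galerkinField N x) = burgersField (fun k => modeExt N k x) k :=
  modeExt_apply burgersField_zero (fun k => burgersField_neg (fun k => modeExt_neg k x) k) hk

lemma hasDerivAt_sum_weight_norm_sq {S : Finset ℤ} {a : ℝ → ℤ → ℂ} {a' : ℤ → ℂ} {t : ℝ}
    (W : ℤ → ℝ) (h : ∀ k ∈ S, HasDerivAt (fun τ => a τ k) (a' k) t) :
    HasDerivAt (fun τ => ∑ k ∈ S, W k * ‖a τ k‖ ^ 2)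
      (∑ k ∈ S, W k * (2 * (star (a t k) * a' k).re)) t := by
  refine HasDerivAt.fun_sum fun k hk => HasDerivAt.const_mul _ ?_
  have := (h k hk).norm_sq
  refine this.congr_deriv ?_
  rw [Complex.inner, Complex.star_def, mul_comm (a' k)]

/-- A Galerkin approximation of the Burgers flow on the Fourier side. -/
structure IsGalerkin (N : ℕ) (T : ℝ) (c : ℤ → ℂ) (a : ℝ → ℤ → ℂ) : Prop where
  neg : ∀ t k, a t (-k) = star (a t k)
  zero : ∀ t, a t 0 = 0
  support : ∀ t, ∀ k ∉ Finset.Icc (-N : ℤ) N, a t k = 0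
  initial : ∀ k ∈ Finset.Icc (-N : ℤ) N, a 0 k = c k
  deriv : ∀ t ∈ Set.Icc 0 T, ∀ k ∈ Finset.Icc (-N : ℤ) N,
    HasDerivAt (fun τ => a τ k) (burgersField (a t) k) t

/-- The field is multiplied by a bump function to obtain a global flow. A nonnegative factor does
not spoil the monotonicity of the energy, so the trajectory remains where the bump equals 1 and
solves the original system. -/
theorem exists_isGalerkin (N : ℕ) {T : ℝ} (hT : 0 ≤ T) {c : ℤ → ℂ} (hc0 : c 0 = 0)
    (hc : ∀ k, c (-k) = star (c k)) : ∃ a, IsGalerkin N T c a := by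
  set x₀ : Fin N → ℂ := fun i => c (i + 1)
  set y : (Fin N → ℂ) → ℝ := fun x => ∑ k ∈ Finset.Icc (-N : ℤ) N, ‖modeExt N k x‖ ^ 2 with hy
  let χ : ContDiffBump (0 : Fin N → ℂ) :=
    ⟨√(y x₀) + 1, √(y x₀) + 2, by positivity, by linarith⟩
  have hv : ContDiff ℝ 1 fun x => χ x • galerkinField N x :=
    χ.contDiff.smul (contDiff_galerkinField N)
  -- The margin `T + 1` provides two-sided derivatives at both ends of `[0, T]`.
  obtain ⟨α, h0, hα⟩ := exists_integralCurve_of_hasCompactSupport hv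
    (χ.hasCompactSupport.smul_right) x₀ (by linarith : 0 < T + 1)
  have hder : ∀ t ∈ Set.Ioo (-(T + 1)) (T + 1), ∀ k ∈ Finset.Icc (-N : ℤ) N,
      HasDerivAt (fun τ => modeExt N k (α τ))
        (χ (α t) • burgersField (fun k => modeExt N k (α t)) k) t := by
    intro t ht k hk
    have := (modeExt N k).hasFDerivAt.comp_hasDerivAt t (hα t ht)
    rw [map_smul, modeExt_galerkinField _ hk] at this
    exact this
  have hsub : Set.Icc 0 T ⊆ Set.Ioo (-(T + 1)) (T + 1) := fun t ht =>
    ⟨by linarith [ht.1], by linarith [ht.2]⟩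
  have dy : ∀ t ∈ Set.Icc 0 T, HasDerivAt (fun τ => y (α τ)) (χ (α t) *
      (-2 * ∑ k ∈ Finset.Icc (-N : ℤ) N, ‖modeExt N k (α t)‖ ^ 2 / |(k : ℝ)|)) t := by
    intro t ht
    have := hasDerivAt_sum_weight_norm_sq (fun _ => 1) (hder t (hsub ht))
    simp only [one_mul] at this
    refine this.congr_deriv ?_
    rw [← sum_re_burgersField (fun k hk => modeExt_eq_zero hk _) (fun k => modeExt_neg k _),
      Finset.mul_sum]
    refine Finset.sum_congr rfl fun k _ => ?_
    rw [mul_smul_comm, Complex.smul_re, smul_eq_mul]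
    ring
  have anti : AntitoneOn (fun τ => y (α τ)) (Set.Icc 0 T) := by
    refine antitoneOn_of_deriv_nonpos (convex_Icc 0 T)
      (fun s hs => (dy s hs).continuousAt.continuousWithinAt)
      (fun s hs => (dy s (interior_subset hs)).differentiableAt.differentiableWithinAt)
      fun s hs => ?_
    rw [(dy s (interior_subset hs)).deriv]
    refine mul_nonpos_of_nonneg_of_nonpos χ.nonneg ?_
    have : 0 ≤ ∑ k ∈ Finset.Icc (-N : ℤ) N, ‖modeExt N k (α s)‖ ^ 2 / |(k : ℝ)| :=
      Finset.sum_nonneg fun k _ => by positivity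
    linarith
  refine ⟨fun t k => modeExt N k (α t), fun t k => modeExt_neg k _, fun t => modeExt_zero _,
    fun t k hk => modeExt_eq_zero hk _, fun k hk => ?_, fun t ht k hk => ?_⟩
  · simp only [h0]; exact modeExt_apply hc0 hc hk
  · have hχ : χ (α t) = 1 := by
      refine χ.one_of_mem_closedBall ?_
      rw [mem_closedBall_zero_iff]
      have h1 : y (α t) ≤ y x₀ := by
        have := anti ⟨le_rfl, hT⟩ ht ht.1
        simpa only [h0] using this
      refine (norm_le_sqrt_modeExt _).trans ((Real.sqrt_le_sqrt h1).trans ?_)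
      change _ ≤ √(y x₀) + 1
      linarith
    have := hder t (hsub ht) k hk
    rwa [hχ, one_smul] at this

/-! ### Bounds uniform in the truncation -/

/-- For `n = 1` the cutoff is invisible on integers. -/
lemma sobWeight_one_intCast (k : ℤ) : sobWeight 1 k = (k : ℝ) ^ 8 := by
  rcases eq_or_ne k 0 with rfl | hk
  · simp [sobWeight]
  · have : (1 : ℝ) ≤ |(k : ℝ)| := by exact_mod_cast Int.one_le_abs hk
    simp [sobWeight, cutWeight, this]

lemma le_sobWeight_one_mul {x : ℝ} (k : ℤ) (hk : k = 0 → x = 0) (hx : 0 ≤ x) :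
    x ≤ sobWeight 1 k * x := by
  rcases eq_or_ne k 0 with rfl | h0
  · simp [hk rfl]
  · have h1 : (1 : ℝ) ≤ |(k : ℝ)| := by exact_mod_cast Int.one_le_abs h0
    have : (1 : ℝ) ≤ (k : ℝ) ^ 8 := by
      rw [← abs_of_nonneg (by positivity : 0 ≤ (k : ℝ) ^ 8), abs_pow]; exact one_le_pow₀ h1
    rw [sobWeight_one_intCast]
    nlinarith

/-- The constant of the energy inequality `M' ≤ K (Y M)^(1/4) M`. -/
noncomputable def energyConst : ℝ := 4610 * √(∑' k : ℤ, 1 / (k : ℝ) ^ 2)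

lemma energyConst_nonneg : 0 ≤ energyConst := by unfold energyConst; positivity

lemma IsGalerkin.apriori {N : ℕ} {T Q : ℝ} {c : ℤ → ℂ} {a : ℝ → ℤ → ℂ} (h : IsGalerkin N T c a)
    (hQ : 0 < Q) (hKQ : 12 * energyConst * Q ^ 4 ≤ 1)
    (hc : ∑ k ∈ Finset.Icc (-N : ℤ) N, sobWeight 1 k * ‖c k‖ ^ 2 ≤ Q ^ 8 / 2)
    {t : ℝ} (ht : t ∈ Set.Icc 0 T) :
    ∑ k ∈ Finset.Icc (-N : ℤ) N, sobWeight 1 k * ‖a t k‖ ^ 2 ≤ (2 * Q) ^ 8 ∧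
    ∑ k ∈ Finset.Icc (-N : ℤ) N, ‖a t k‖ ^ 2 ≤ (32 * Q / (1 + t)) ^ 8 := by
  set S := Finset.Icc (-N : ℤ) N
  -- Adding `e` keeps `Y` and `M` positive, so that their eighth roots are differentiable. It
  -- behaves like the energy of a mode of frequency 1 with `e' = -2 e`, and respects every
  -- inequality required; it takes up the other half of `Q ^ 8`.
  set e : ℝ → ℝ := fun s => Q ^ 8 / 2 * Real.exp (-2 * s) with he
  have e0 : ∀ s, 0 < e s := fun s => by positivity
  have de : ∀ s, HasDerivAt e (-2 * e s) s := fun s => by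
    have := (((hasDerivAt_id s).const_mul (-2)).exp).const_mul (Q ^ 8 / 2)
    exact this.congr_deriv (by simp [he]; ring)
  have W0 : ∀ k : ℤ, 0 ≤ sobWeight 1 k := fun k => sobWeight_nonneg one_pos _
  set Y : ℝ → ℝ := fun s => ∑ k ∈ S, ‖a s k‖ ^ 2 + e s with hY
  set M : ℝ → ℝ := fun s => ∑ k ∈ S, sobWeight 1 k * ‖a s k‖ ^ 2 + e s with hM
  set H : ℝ → ℝ := fun s => ∑ k ∈ S, ‖a s k‖ ^ 2 / |(k : ℝ)| + e s with hH
  set M' : ℝ → ℝ := fun s =>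
    ∑ k ∈ S, sobWeight 1 k * (2 * (star (a s k) * burgersField (a s) k).re) + -2 * e s with hM'
  have Yn : ∀ s, 0 ≤ ∑ k ∈ S, ‖a s k‖ ^ 2 := fun s => Finset.sum_nonneg fun k _ => by positivity
  have Mn : ∀ s, 0 ≤ ∑ k ∈ S, sobWeight 1 k * ‖a s k‖ ^ 2 := fun s =>
    Finset.sum_nonneg fun k _ => mul_nonneg (W0 k) (by positivity)
  have key := energy_decay (T := T) energyConst_nonneg hQ hKQ (Y := Y) (M := M) (H := H)
    (M' := M') (fun s _ => by have := Yn s; have := e0 s; simp only [hY]; linarith)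
    (fun s _ => by have := Mn s; have := e0 s; simp only [hM]; linarith) ?_ ?_ ?_ ?_ ?_ ?_ ht
  · have := e0 t
    simp only [hM, hY] at key
    exact ⟨by linarith [key.1], by linarith [key.2]⟩
  · intro s hs
    have := (hasDerivAt_sum_weight_norm_sq (fun _ => 1) (h.deriv s hs)).add (de s)
    simp only [one_mul, sum_re_burgersField (h.support s) (h.neg s)] at this
    exact this.congr_deriv (by simp only [hH]; ring)
  · intro s hs
    exact (hasDerivAt_sum_weight_norm_sq (fun k : ℤ => sobWeight 1 k) (h.deriv s hs)).add (de s)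
  · intro s hs
    have h1 := sum_sobWeight_re_burgersField_le one_pos (h.support s) (h.neg s)
    have h2 := sum_abs_mul_norm_le (N := N) (a := a s) (Y := Y s) (M := M s)
      (by simp only [hY]; linarith [e0 s]) (by simp only [hM]; linarith [e0 s])
    have h3 : ∑ k ∈ S, sobWeight 1 k * ‖a s k‖ ^ 2 ≤ M s := by simp only [hM]; linarith [e0 s]
    have h4 : 4610 * (∑ k ∈ S, |(k : ℝ)| * ‖a s k‖) ≤ energyConst * √√(Y s * M s) := by
      unfold energyConst; linarith
    have := mul_le_mul h4 h3 (Mn s) (mul_nonneg energyConst_nonneg (Real.sqrt_nonneg _))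
    simp only [hM'] at *
    linarith [e0 s]
  · intro s hs R hR
    have h1 : e s ≤ R * e s + e s / R ^ 8 := by
      have := norm_sq_le_interpolation 1 (by simp) (e0 s).le hR
      simpa [sobWeight, cutWeight] using this
    have h2 : ∑ k ∈ S, ‖a s k‖ ^ 2 ≤ ∑ k ∈ S, (R * (‖a s k‖ ^ 2 / |(k : ℝ)|) +
        sobWeight 1 k * ‖a s k‖ ^ 2 / R ^ 8) := Finset.sum_le_sum fun k _ =>
      norm_sq_le_interpolation k (fun hk => by simp [hk, h.zero]) (by positivity) hR
    rw [Finset.sum_add_distrib, ← Finset.mul_sum, ← Finset.sum_div] at h2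
    simp only [hY, hM, hH]
    rw [mul_add, add_div]
    linarith
  all_goals
    have hi : ∑ k ∈ S, sobWeight 1 k * ‖a 0 k‖ ^ 2 ≤ Q ^ 8 / 2 := by
      rwa [Finset.sum_congr rfl fun k hk => by rw [h.initial k hk]]
    have he0 : e 0 = Q ^ 8 / 2 := by simp [he]
  · have : ∑ k ∈ S, ‖a 0 k‖ ^ 2 ≤ ∑ k ∈ S, sobWeight 1 k * ‖a 0 k‖ ^ 2 :=
      Finset.sum_le_sum fun k _ =>
        le_sobWeight_one_mul k (fun hk => by simp [hk, h.zero]) (by positivity)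
    simp only [hY]; linarith
  · simp only [hM]; linarith

/-- The exponential rate in the weighted energy estimates. -/
noncomputable def energyRate (Q : ℝ) : ℝ := energyConst * √√((32 * Q) ^ 8 * (2 * Q) ^ 8)

/-- Grönwall with a rate independent of both `n` and `N`. For large `n` the weight sees mostly high
frequencies, so this is a uniform tail estimate. -/
lemma IsGalerkin.weighted_energy_le {N : ℕ} {T Q : ℝ} {c : ℤ → ℂ} {a : ℝ → ℤ → ℂ}
    (h : IsGalerkin N T c a) (hQ : 0 < Q) (hKQ : 12 * energyConst * Q ^ 4 ≤ 1)
    (hc : ∑ k ∈ Finset.Icc (-N : ℤ) N, sobWeight 1 k * ‖c k‖ ^ 2 ≤ Q ^ 8 / 2)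
    {n : ℝ} (hn : 0 < n) {t : ℝ} (ht : t ∈ Set.Icc 0 T) :
    ∑ k ∈ Finset.Icc (-N : ℤ) N, sobWeight n k * ‖a t k‖ ^ 2 ≤
      Real.exp (energyRate Q * t) *
        ∑ k ∈ Finset.Icc (-N : ℤ) N, sobWeight n k * ‖c k‖ ^ 2 := by
  set S := Finset.Icc (-N : ℤ) N
  set E : ℝ → ℝ := fun s => ∑ k ∈ S, sobWeight n k * ‖a s k‖ ^ 2 with hE
  have E0 : ∀ s, 0 ≤ E s := fun s =>
    Finset.sum_nonneg fun k _ => mul_nonneg (sobWeight_nonneg hn _) (by positivity)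
  have dE : ∀ s ∈ Set.Icc 0 T, ∃ E', HasDerivAt E E' s ∧ E' ≤ energyRate Q * E s := by
    intro s hs
    refine ⟨_, hasDerivAt_sum_weight_norm_sq (fun k : ℤ => sobWeight n k) (h.deriv s hs), ?_⟩
    refine (sum_sobWeight_re_burgersField_le hn (h.support s) (h.neg s)).trans ?_
    refine mul_le_mul_of_nonneg_right ?_ (E0 s)
    obtain ⟨hM, hY⟩ := h.apriori hQ hKQ hc hs
    have hY' : ∑ k ∈ S, ‖a s k‖ ^ 2 ≤ (32 * Q) ^ 8 := by
      refine hY.trans (pow_le_pow_left₀ (div_nonneg (by positivity) (by linarith [hs.1])) ?_ 8)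
      exact div_le_self (by positivity) (by linarith [hs.1])
    have := sum_abs_mul_norm_le hY' hM
    unfold energyRate energyConst
    linarith
  choose! E' hE' hle using dE
  have dG : ∀ s ∈ Set.Icc 0 T, HasDerivAt (fun s => E s * Real.exp (-(energyRate Q * s)))
      (E' s * Real.exp (-(energyRate Q * s)) +
        E s * (Real.exp (-(energyRate Q * s)) * -(energyRate Q))) s := fun s hs => by
    have := (hE' s hs).mul (((hasDerivAt_id s).const_mul (energyRate Q)).neg.exp)
    exact this.congr_deriv (by simp)
  have anti : AntitoneOn (fun s => E s * Real.exp (-(energyRate Q * s))) (Set.Icc 0 T) := by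
    refine antitoneOn_of_deriv_nonpos (convex_Icc 0 T)
      (fun s hs => (dG s hs).continuousAt.continuousWithinAt)
      (fun s hs => (dG s (interior_subset hs)).differentiableAt.differentiableWithinAt)
      fun s hs => ?_
    rw [(dG s (interior_subset hs)).deriv]
    have := hle s (interior_subset hs)
    have h0 := Real.exp_pos (-(energyRate Q * s))
    nlinarith
  have h1 := anti ⟨le_rfl, ht.1.trans ht.2⟩ ht ht.1
  simp only [mul_zero, neg_zero, Real.exp_zero, mul_one] at h1
  have h2 : E 0 = ∑ k ∈ S, sobWeight n k * ‖c k‖ ^ 2 :=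
    Finset.sum_congr rfl fun k hk => by rw [h.initial k hk]
  rw [← h2]
  rw [Real.exp_neg, ← div_eq_mul_inv, div_le_iff₀ (Real.exp_pos _)] at h1
  linarith

/-! ### Polynomial decay of coefficients and convolution -/

/-- The mass of the weight `(1 + |k|)⁻²`. -/
noncomputable def bracketMass : ℝ := ∑' k : ℤ, 1 / (1 + |(k : ℝ)|) ^ 2

lemma summable_bracket : Summable fun k : ℤ => 1 / (1 + |(k : ℝ)|) ^ 2 := by
  have hs : Summable fun k : ℤ => 1 / (k : ℝ) ^ 2 := by
    simpa using Real.summable_one_div_int_pow.2 (by norm_num : 1 < 2)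
  refine Summable.of_norm_bounded_eventually hs ?_
  filter_upwards [(Set.finite_singleton (0 : ℤ)).compl_mem_cofinite] with k hk
  have hk : k ≠ 0 := by simpa using hk
  have : 0 < |(k : ℝ)| := by simpa using hk
  rw [Real.norm_of_nonneg (by positivity), ← sq_abs (k : ℝ)]
  gcongr
  linarith

lemma bracketMass_nonneg : 0 ≤ bracketMass := tsum_nonneg fun k => by positivity

/-- Polynomial decay of order `s` of a sequence of Fourier coefficients. -/
def HasDecay (s : ℕ) (A : ℝ) (a : ℤ → ℂ) : Prop := ∀ k : ℤ, ‖a k‖ ≤ A / (1 + |(k : ℝ)|) ^ s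

lemma HasDecay.const_nonneg {s : ℕ} {A : ℝ} {a : ℤ → ℂ} (h : HasDecay s A a) : 0 ≤ A := by
  simpa using (norm_nonneg _).trans (h 0)

lemma HasDecay.mono {s r : ℕ} {A : ℝ} {a : ℤ → ℂ} (h : HasDecay s A a) (hr : r ≤ s) :
    HasDecay r A a := fun k => by
  refine (h k).trans (div_le_div_of_nonneg_left h.const_nonneg (by positivity) ?_)
  exact pow_le_pow_right₀ (by linarith [abs_nonneg (k : ℝ)]) hr

/-- One of `j`, `k - j` is comparable to `k`: the larger bracket is at least half of `1 + |k|` and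
supplies the decay in `k`, while the smaller one remains summable in `j`. -/
lemma HasDecay.norm_mul_le {s : ℕ} (hs : 2 ≤ s) {A B : ℝ} {a b : ℤ → ℂ} (ha : HasDecay s A a)
    (hb : HasDecay s B b) (k j : ℤ) : ‖a j * b (k - j)‖ ≤
      2 ^ s * A * B / (1 + |(k : ℝ)|) ^ s *
        (1 / (1 + |(j : ℝ)|) ^ 2 + 1 / (1 + |((k - j : ℤ) : ℝ)|) ^ 2) := by
  have hA := ha.const_nonneg
  have hB := hb.const_nonneg
  have htri : |(k : ℝ)| ≤ |(j : ℝ)| + |((k - j : ℤ) : ℝ)| := by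
    have := abs_add_le (j : ℝ) ((k - j : ℤ) : ℝ)
    push_cast at this ⊢
    rwa [add_sub_cancel] at this
  set x := 1 + |(j : ℝ)| with hx
  set y := 1 + |((k - j : ℤ) : ℝ)| with hy
  set z := 1 + |(k : ℝ)| with hz
  have hx1 : 1 ≤ x := by rw [hx]; linarith [abs_nonneg (j : ℝ)]
  have hy1 : 1 ≤ y := by rw [hy]; linarith [abs_nonneg ((k - j : ℤ) : ℝ)]
  have hz1 : 1 ≤ z := by rw [hz]; linarith [abs_nonneg (k : ℝ)]
  have hzxy : z ≤ x + y := by linarith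
  have key : 1 / (x ^ s * y ^ s) ≤ 2 ^ s / z ^ s * (1 / x ^ 2 + 1 / y ^ 2) := by
    have aux : ∀ x y : ℝ, 1 ≤ x → 1 ≤ y → z ≤ x + y → x ≤ y →
        1 / (x ^ s * y ^ s) ≤ 2 ^ s / z ^ s * (1 / x ^ 2 + 1 / y ^ 2) := by
      intro x y hx hy hz hxy
      have h1 : 1 / y ^ s ≤ 2 ^ s / z ^ s := by
        rw [← one_div_pow, ← div_pow]
        refine pow_le_pow_left₀ (by positivity) ?_ s
        rw [div_le_div_iff₀ (by positivity) (by positivity)]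
        linarith
      have h2 : 1 / x ^ s ≤ 1 / x ^ 2 := by gcongr
      have h3 : 0 ≤ 1 / y ^ 2 := by positivity
      calc 1 / (x ^ s * y ^ s) = 1 / y ^ s * (1 / x ^ s) := by rw [one_div_mul_one_div, mul_comm]
        _ ≤ 2 ^ s / z ^ s * (1 / x ^ 2 + 1 / y ^ 2) := by gcongr; linarith
    rcases le_total x y with h | h
    · exact aux x y hx1 hy1 hzxy h
    · rw [mul_comm, add_comm]; exact aux y x hy1 hx1 (by linarith) h
  calc ‖a j * b (k - j)‖ ≤ A / x ^ s * (B / y ^ s) := by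
        rw [norm_mul]; exact mul_le_mul (ha j) (hb (k - j)) (norm_nonneg _) (by positivity)
    _ = A * B * (1 / (x ^ s * y ^ s)) := by field_simp
    _ ≤ A * B * (2 ^ s / z ^ s * (1 / x ^ 2 + 1 / y ^ 2)) := by gcongr
    _ = _ := by ring

lemma summable_sub_left {f : ℤ → ℝ} (hf : Summable f) (k : ℤ) : Summable fun j => f (k - j) :=
  (Equiv.subLeft k).summable_iff.2 hf

lemma tsum_sub_left (f : ℤ → ℝ) (k : ℤ) : ∑' j, f (k - j) = ∑' j, f j :=
  (Equiv.subLeft k).tsum_eq f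

lemma summable_bracket_shift (k : ℤ) : Summable fun j : ℤ =>
    1 / (1 + |(j : ℝ)|) ^ 2 + 1 / (1 + |((k - j : ℤ) : ℝ)|) ^ 2 :=
  summable_bracket.add (summable_sub_left summable_bracket k)

lemma HasDecay.summable_mul {s : ℕ} (hs : 2 ≤ s) {A B : ℝ} {a b : ℤ → ℂ} (ha : HasDecay s A a)
    (hb : HasDecay s B b) (k : ℤ) : Summable fun j => a j * b (k - j) :=
  .of_norm_bounded ((summable_bracket_shift k).mul_left _) (ha.norm_mul_le hs hb k)

lemma HasDecay.norm_conv_le {s : ℕ} (hs : 2 ≤ s) {A B : ℝ} {a b : ℤ → ℂ} (ha : HasDecay s A a)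
    (hb : HasDecay s B b) (k : ℤ) :
    ‖∑' j, a j * b (k - j)‖ ≤ 2 ^ s * A * B * (2 * bracketMass) / (1 + |(k : ℝ)|) ^ s := by
  refine (tsum_of_norm_bounded ((summable_bracket_shift k).mul_left _).hasSum
    (ha.norm_mul_le hs hb k)).trans_eq ?_
  have h2 : Summable fun j : ℤ => 1 / (1 + |((k - j : ℤ) : ℝ)|) ^ 2 :=
    summable_sub_left summable_bracket k
  have e : ∑' j : ℤ, 1 / (1 + |((k - j : ℤ) : ℝ)|) ^ 2 = bracketMass :=
    tsum_sub_left (fun j : ℤ => 1 / (1 + |(j : ℝ)|) ^ 2) k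
  rw [tsum_mul_left, summable_bracket.tsum_add h2, e, ← bracketMass]
  ring

lemma norm_div_abs_le (z : ℂ) (k : ℤ) : ‖z / ((|(k : ℝ)| : ℝ) : ℂ)‖ ≤ ‖z‖ := by
  rw [norm_div, Complex.norm_real, norm_abs_eq_norm]
  rcases eq_or_ne k 0 with rfl | hk
  · simp
  · have : (1 : ℝ) ≤ |(k : ℝ)| := by exact_mod_cast Int.one_le_abs hk
    exact div_le_self (norm_nonneg _) this

lemma norm_I_mul_le {z : ℂ} {k : ℤ} {C : ℝ} {s : ℕ}
    (h : ‖z‖ ≤ C / (1 + |(k : ℝ)|) ^ (s + 1)) :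
    ‖Complex.I * k / 2 * z‖ ≤ C / (1 + |(k : ℝ)|) ^ s := by
  have h0 := abs_nonneg (k : ℝ)
  rw [norm_mul, norm_div, norm_mul, Complex.norm_I, one_mul, Complex.norm_intCast, RCLike.norm_ofNat]
  calc |(k : ℝ)| / 2 * ‖z‖ ≤ (1 + |(k : ℝ)|) * (C / (1 + |(k : ℝ)|) ^ (s + 1)) := by
        gcongr; linarith
    _ = _ := by field_simp; ring

/-- Convolution preserves the order of decay and the derivative costs one power. -/
lemma HasDecay.burgersField {A : ℝ} {a : ℤ → ℂ} (ha : HasDecay 4 A a) :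
    HasDecay 3 (A + 32 * A ^ 2 * bracketMass) (burgersField a) := fun k => by
  have h1 := norm_I_mul_le
    (ha.norm_conv_le (by norm_num) ha k)
  have h2 := (norm_div_abs_le (a k) k).trans (ha.mono (by norm_num : 3 ≤ 4) k)
  rw [_root_.burgersField, add_div]
  refine (norm_sub_le _ _).trans (add_le_add (by rwa [norm_neg]) (h1.trans_eq ?_))
  ring

/-- The difference of the convolutions is split bilinearly. The remaining order 2 is still summable
in `k`. -/
lemma HasDecay.burgersField_sub {A D : ℝ} {a b : ℤ → ℂ} (ha : HasDecay 4 A a)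
    (hb : HasDecay 4 A b) (hab : HasDecay 3 D fun k => a k - b k) (k : ℤ) :
    ‖_root_.burgersField a k - _root_.burgersField b k‖ ≤
      (D + 32 * A * D * bracketMass) / (1 + |(k : ℝ)|) ^ 2 := by
  have ha3 := ha.mono (by norm_num : 3 ≤ 4)
  have hb3 := hb.mono (by norm_num : 3 ≤ 4)
  have s1 := hab.summable_mul (by norm_num) ha3 k
  have s2 := hb3.summable_mul (by norm_num) hab k
  have e : _root_.burgersField a k - _root_.burgersField b k =
      -((a k - b k) / ((|(k : ℝ)| : ℝ) : ℂ)) - Complex.I * k / 2 * ((∑' j, (a j - b j) * a (k - j)) +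
        ∑' j, b j * (a (k - j) - b (k - j))) := by
    rw [← s1.tsum_add s2, _root_.burgersField, _root_.burgersField]
    have : ∑' j, ((a j - b j) * a (k - j) + b j * (a (k - j) - b (k - j))) =
        ∑' j, a j * a (k - j) - ∑' j, b j * b (k - j) := by
      rw [← (ha3.summable_mul (by norm_num) ha3 k).tsum_sub
        (hb3.summable_mul (by norm_num) hb3 k)]
      exact tsum_congr fun j => by ring
    rw [this]; ring
  have h1 : ‖(∑' j, (a j - b j) * a (k - j)) + ∑' j, b j * (a (k - j) - b (k - j))‖ ≤
      32 * A * D * bracketMass / (1 + |(k : ℝ)|) ^ 3 := by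
    refine (norm_add_le _ _).trans ((add_le_add (hab.norm_conv_le (by norm_num) ha3 k)
      (hb3.norm_conv_le (by norm_num) hab k)).trans_eq ?_)
    ring
  have h2 := norm_I_mul_le h1
  have h3 := (norm_div_abs_le (a k - b k) k).trans (hab.mono (by norm_num : 2 ≤ 3) k)
  rw [e, add_div]
  exact (norm_sub_le _ _).trans (add_le_add (by rwa [norm_neg]) h2)

/-! ### Passage to the limit -/

/-- A curve of Fourier coefficients solving the Burgers flow, with the estimates it inherits from
its Galerkin approximations. -/
structure IsFourierSolution (Q A κ : ℝ) (c : ℤ → ℂ) (a : ℝ → ℤ → ℂ) : Prop where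
  neg : ∀ t, 0 ≤ t → ∀ k, a t (-k) = star (a t k)
  initial : ∀ k, a 0 k = c k
  zero : ∀ t, 0 ≤ t → a t 0 = 0
  decay : ∀ t, 0 ≤ t → HasDecay 4 A (a t)
  deriv : ∀ t, 0 ≤ t → ∀ s, 0 ≤ s → ∀ k : ℤ,
    ‖a s k - a t k - (s - t : ℝ) * burgersField (a t) k‖ ≤ κ * (s - t) ^ 2 / (1 + |(k : ℝ)|) ^ 2
  l2_le : ∀ t, 0 ≤ t → ∀ S : Finset ℤ, ∑ k ∈ S, ‖a t k‖ ^ 2 ≤ (32 * Q / (1 + t)) ^ 8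
  weighted_le : ∀ t, 0 ≤ t → ∀ n : ℝ, 0 < n → ∀ S : Finset ℤ,
    ∑ k ∈ S, sobWeight n k * ‖a t k‖ ^ 2 ≤
      Real.exp (energyRate Q * t) * ∑' k : ℤ, sobWeight n k * ‖c k‖ ^ 2

lemma sobWeight_le_one_intCast (n : ℝ) (k : ℤ) : sobWeight n k ≤ sobWeight 1 k := by
  rw [sobWeight_one_intCast, sobWeight]
  exact mul_le_of_le_one_right (by positivity) (cutWeight_le_one n k)

lemma sum_le_of_forall_Icc {f : ℤ → ℝ} {B : ℝ} {N : ℕ} (hf : ∀ k, 0 ≤ f k)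
    (h0 : ∀ k ∉ Finset.Icc (-N : ℤ) N, f k = 0) (hB : ∑ k ∈ Finset.Icc (-N : ℤ) N, f k ≤ B)
    (S : Finset ℤ) : ∑ k ∈ S, f k ≤ B := by
  have hs : HasSum f (∑ k ∈ Finset.Icc (-N : ℤ) N, f k) := hasSum_sum_of_ne_finset_zero h0
  exact (sum_le_hasSum S (fun k _ => hf k) hs).trans hB

/-- The decay constant of the Galerkin approximations. -/
noncomputable def decayConst (Q : ℝ) : ℝ := 16 * (2 * Q) ^ 4

lemma IsGalerkin.hasDecay {N : ℕ} {T Q : ℝ} {c : ℤ → ℂ} {a : ℝ → ℤ → ℂ} (h : IsGalerkin N T c a)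
    (hQ : 0 < Q) (hKQ : 12 * energyConst * Q ^ 4 ≤ 1)
    (hc : ∑ k ∈ Finset.Icc (-N : ℤ) N, sobWeight 1 k * ‖c k‖ ^ 2 ≤ Q ^ 8 / 2)
    {t : ℝ} (ht : t ∈ Set.Icc 0 T) : HasDecay 4 (decayConst Q) (a t) := by
  intro k
  rcases eq_or_ne k 0 with rfl | hk
  · rw [h.zero, norm_zero]; unfold decayConst; positivity
  have h1 := sum_le_of_forall_Icc (fun k => mul_nonneg (sobWeight_nonneg one_pos _) (by positivity))
    (fun k hk => by simp [h.support t k hk]) (h.apriori hQ hKQ hc ht).1 {k}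
  rw [Finset.sum_singleton, sobWeight_one_intCast] at h1
  have hk1 : (1 : ℝ) ≤ |(k : ℝ)| := by exact_mod_cast Int.one_le_abs hk
  have h2 : |(k : ℝ)| ^ 4 * ‖a t k‖ ≤ (2 * Q) ^ 4 := by
    refine le_of_pow_le_pow_left₀ (n := 2) two_ne_zero (by positivity) ?_
    calc (|(k : ℝ)| ^ 4 * ‖a t k‖) ^ 2 = (k : ℝ) ^ 8 * ‖a t k‖ ^ 2 := by
          rw [mul_pow, ← pow_mul, ← abs_pow, abs_of_nonneg (Even.pow_nonneg (by decide) _)]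
      _ ≤ _ := by rw [← pow_mul]; exact h1
  rw [le_div_iff₀ (by positivity)]
  calc ‖a t k‖ * (1 + |(k : ℝ)|) ^ 4 ≤ ‖a t k‖ * (2 * |(k : ℝ)|) ^ 4 := by gcongr; linarith
    _ = 16 * (|(k : ℝ)| ^ 4 * ‖a t k‖) := by ring
    _ ≤ _ := by unfold decayConst; gcongr

/-- The time Lipschitz constant of the Galerkin approximations. -/
noncomputable def speedConst (Q : ℝ) : ℝ :=
  decayConst Q + 32 * decayConst Q ^ 2 * bracketMass

/-- The constant in the quadratic Taylor remainder of the Galerkin approximations. -/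
noncomputable def remainderConst (Q : ℝ) : ℝ :=
  speedConst Q + 32 * decayConst Q * speedConst Q * bracketMass

lemma speedConst_nonneg {Q : ℝ} (hQ : 0 < Q) : 0 ≤ speedConst Q := by
  have := bracketMass_nonneg
  unfold speedConst decayConst; positivity

lemma IsGalerkin.norm_sub_le {N : ℕ} {T Q : ℝ} {c : ℤ → ℂ} {a : ℝ → ℤ → ℂ}
    (h : IsGalerkin N T c a) (hQ : 0 < Q) (hKQ : 12 * energyConst * Q ^ 4 ≤ 1)
    (hc : ∑ k ∈ Finset.Icc (-N : ℤ) N, sobWeight 1 k * ‖c k‖ ^ 2 ≤ Q ^ 8 / 2)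
    {s t : ℝ} (hs : s ∈ Set.Icc 0 T) (ht : t ∈ Set.Icc 0 T) :
    HasDecay 3 (speedConst Q * |s - t|) fun k => a s k - a t k := by
  intro k
  by_cases hk : k ∈ Finset.Icc (-N : ℤ) N
  · have := (convex_Icc 0 T).norm_image_sub_le_of_norm_hasDerivWithin_le
      (f := fun τ => a τ k) (C := speedConst Q / (1 + |(k : ℝ)|) ^ 3)
      (fun τ hτ => (h.deriv τ hτ k hk).hasDerivWithinAt)
      (fun τ hτ => (h.hasDecay hQ hKQ hc hτ).burgersField k) ht hs
    refine this.trans_eq ?_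
    rw [Real.norm_eq_abs]; ring
  · simp only [h.support s k hk, h.support t k hk, sub_zero, norm_zero]
    have := speedConst_nonneg hQ
    positivity

/-- The mean value inequality for `a τ - τ * burgersField (a t)`, whose derivative is `O(|τ - t|)`.
A quadratic Taylor bound, unlike a derivative, survives pointwise limits. -/
lemma IsGalerkin.norm_remainder_le {N : ℕ} {T Q : ℝ} {c : ℤ → ℂ} {a : ℝ → ℤ → ℂ}
    (h : IsGalerkin N T c a) (hQ : 0 < Q) (hKQ : 12 * energyConst * Q ^ 4 ≤ 1)
    (hc : ∑ k ∈ Finset.Icc (-N : ℤ) N, sobWeight 1 k * ‖c k‖ ^ 2 ≤ Q ^ 8 / 2)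
    {s t : ℝ} (hs : s ∈ Set.Icc 0 T) (ht : t ∈ Set.Icc 0 T) {k : ℤ}
    (hk : k ∈ Finset.Icc (-N : ℤ) N) :
    ‖a s k - a t k - (s - t : ℝ) * burgersField (a t) k‖ ≤
      remainderConst Q * (s - t) ^ 2 / (1 + |(k : ℝ)|) ^ 2 := by
  have hsub : Set.uIcc t s ⊆ Set.Icc 0 T := Set.uIcc_subset_Icc ht hs
  have d : ∀ τ ∈ Set.uIcc t s, HasDerivWithinAt
      (fun τ : ℝ => a τ k - (τ : ℂ) * burgersField (a t) k)
      (burgersField (a τ) k - burgersField (a t) k) (Set.uIcc t s) τ := fun τ hτ => by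
    have h1 := (Complex.ofRealCLM.hasDerivAt (x := τ)).mul_const (burgersField (a t) k)
    have := (h.deriv τ (hsub hτ) k hk).sub h1
    exact (this.congr_deriv (by simp)).hasDerivWithinAt
  have b : ∀ τ ∈ Set.uIcc t s, ‖burgersField (a τ) k - burgersField (a t) k‖ ≤
      remainderConst Q * |s - t| / (1 + |(k : ℝ)|) ^ 2 := fun τ hτ => by
    refine ((h.hasDecay hQ hKQ hc (hsub hτ)).burgersField_sub (h.hasDecay hQ hKQ hc ht)
      (h.norm_sub_le hQ hKQ hc (hsub hτ) ht) k).trans ?_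
    have e : speedConst Q * |τ - t| + 32 * decayConst Q * (speedConst Q * |τ - t|) * bracketMass =
      remainderConst Q * |τ - t| := by unfold remainderConst; ring
    rw [e]
    have h0 : 0 ≤ remainderConst Q := by
      have := speedConst_nonneg hQ
      have := bracketMass_nonneg
      unfold remainderConst decayConst; positivity
    gcongr ?_ * ?_ / _
    exact Set.abs_sub_left_of_mem_uIcc hτ
  have := (convex_uIcc t s).norm_image_sub_le_of_norm_hasDerivWithin_le d b Set.left_mem_uIcc
    Set.right_mem_uIcc
  calc ‖a s k - a t k - (s - t : ℝ) * burgersField (a t) k‖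
      = ‖a s k - (s : ℂ) * burgersField (a t) k - (a t k - (t : ℂ) * burgersField (a t) k)‖ := by
        congr 1; push_cast; ring
    _ ≤ _ := this
    _ = _ := by rw [Real.norm_eq_abs, ← sq_abs (s - t)]; ring

/-- A fixed ultrafilter gives limits for all times and frequencies simultaneously, with no
extraction of subsequences. -/
lemma exists_tendsto_hyperfilter {f : ℕ → ℂ} {B : ℝ} (h : ∀ᶠ N in atTop, ‖f N‖ ≤ B) :
    ∃ z, Tendsto f (hyperfilter ℕ : Filter ℕ) (𝓝 z) := by
  have h' : ∀ᶠ N in (hyperfilter ℕ : Filter ℕ), ‖f N‖ ≤ B := h.filter_mono Nat.hyperfilter_le_atTop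
  obtain ⟨z, -, hz⟩ := (isCompact_closedBall (0 : ℂ) B).ultrafilter_le_nhds'
    ((hyperfilter ℕ).map f) (by
      rw [Ultrafilter.mem_map]
      filter_upwards [h'] with N hN
      simpa using hN)
  exact ⟨z, hz⟩

/-- The uniform decay dominates the convolution, so coefficientwise convergence suffices for the
nonlinearity. -/
lemma tendsto_burgersField {ι : Type*} {l : Filter ι} {a : ι → ℤ → ℂ} {b : ℤ → ℂ} {A : ℝ}
    (hA : ∀ᶠ N in l, HasDecay 4 A (a N)) (hab : ∀ k, Tendsto (fun N => a N k) l (𝓝 (b k)))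
    (k : ℤ) : Tendsto (fun N => burgersField (a N) k) l (𝓝 (burgersField b k)) := by
  refine Tendsto.sub ((hab k).div_const _).neg (Tendsto.const_mul _ ?_)
  refine tendsto_tsum_of_dominated_convergence ((summable_bracket_shift k).mul_left
    (2 ^ 4 * A * A / (1 + |(k : ℝ)|) ^ 4)) (fun j => (hab j).mul (hab (k - j))) ?_
  filter_upwards [hA] with N hN
  exact hN.norm_mul_le (by norm_num) hN k

theorem exists_isFourierSolution {Q : ℝ} (hQ : 0 < Q) (hKQ : 12 * energyConst * Q ^ 4 ≤ 1)
    {c : ℤ → ℂ} (hc0 : c 0 = 0) (hcn : ∀ k, c (-k) = star (c k))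
    (hsum : Summable fun k : ℤ => sobWeight 1 k * ‖c k‖ ^ 2)
    (hc : ∑' k : ℤ, sobWeight 1 k * ‖c k‖ ^ 2 ≤ Q ^ 8 / 2) :
    ∃ a, IsFourierSolution Q (decayConst Q) (remainderConst Q) c a := by
  -- The `N`-th approximation lives on `[0, N]`, so each fixed time is eventually covered and one
  -- limit serves all `t ≥ 0`.
  choose g hg using fun N : ℕ => exists_isGalerkin N (T := N) N.cast_nonneg hc0 hcn
  have nonneg : ∀ n : ℝ, 0 < n → ∀ k : ℤ, 0 ≤ sobWeight n k * ‖c k‖ ^ 2 := fun n hn k =>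
    mul_nonneg (sobWeight_nonneg hn _) (by positivity)
  have hcN : ∀ N : ℕ, ∑ k ∈ Finset.Icc (-N : ℤ) N, sobWeight 1 k * ‖c k‖ ^ 2 ≤ Q ^ 8 / 2 :=
    fun N => (hsum.sum_le_tsum _ fun k _ => nonneg 1 one_pos k).trans hc
  have mem : ∀ t : ℝ, 0 ≤ t → ∀ᶠ N : ℕ in atTop, t ∈ Set.Icc (0 : ℝ) N := fun t ht => by
    filter_upwards [eventually_ge_atTop ⌈t⌉₊] with N hN
    exact ⟨ht, (Nat.le_ceil t).trans (by exact_mod_cast hN)⟩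
  have memk : ∀ k : ℤ, ∀ᶠ N : ℕ in atTop, k ∈ Finset.Icc (-N : ℤ) N := fun k => by
    filter_upwards [eventually_ge_atTop k.natAbs] with N hN
    rw [Finset.mem_Icc]; omega
  have lim : ∀ t : ℝ, ∀ k : ℤ, ∃ z, 0 ≤ t →
      Tendsto (fun N => g N t k) (hyperfilter ℕ : Filter ℕ) (𝓝 z) := by
    intro t k
    by_cases ht : 0 ≤ t
    · obtain ⟨z, hz⟩ := exists_tendsto_hyperfilter (f := fun N => g N t k)
        (B := decayConst Q / (1 + |(k : ℝ)|) ^ 4) (by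
          filter_upwards [mem t ht] with N hN
          exact (hg N).hasDecay hQ hKQ (hcN N) hN k)
      exact ⟨z, fun _ => hz⟩
    · exact ⟨0, fun h => absurd h ht⟩
  choose a ha using lim
  have up : ∀ {p : ℕ → Prop}, (∀ᶠ N in atTop, p N) → ∀ᶠ N in (hyperfilter ℕ : Filter ℕ), p N :=
    fun h => h.filter_mono Nat.hyperfilter_le_atTop
  have hdec : ∀ t, 0 ≤ t → ∀ᶠ N in (hyperfilter ℕ : Filter ℕ), HasDecay 4 (decayConst Q) (g N t) :=
    fun t ht => up (by
      filter_upwards [mem t ht] with N hN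
      exact (hg N).hasDecay hQ hKQ (hcN N) hN)
  refine ⟨a, ⟨fun t ht k => ?_, fun k => ?_, fun t ht => ?_, fun t ht k => ?_,
    fun t ht s hs k => ?_, fun t ht S => ?_, fun t ht n hn S => ?_⟩⟩
  · refine tendsto_nhds_unique (ha t (-k) ht) ?_
    simp only [(hg _).neg t k]
    exact (continuous_star.tendsto _).comp (ha t k ht)
  · refine tendsto_nhds_unique (ha 0 k le_rfl) (tendsto_const_nhds.congr' ?_)
    filter_upwards [up (memk k)] with N hN
    exact ((hg N).initial k hN).symm
  · refine tendsto_nhds_unique (ha t 0 ht) ?_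
    simp only [(hg _).zero t]
    exact tendsto_const_nhds
  · refine le_of_tendsto (ha t k ht).norm ?_
    filter_upwards [hdec t ht] with N hN using hN k
  · have h1 := tendsto_burgersField (hdec t ht) (fun k => ha t k ht) k
    refine le_of_tendsto (((ha s k hs).sub (ha t k ht)).sub (h1.const_mul _)).norm ?_
    filter_upwards [up (mem t ht), up (mem s hs), up (memk k)] with N hN1 hN2 hN3
    exact (hg N).norm_remainder_le hQ hKQ (hcN N) hN2 hN1 hN3
  · refine le_of_tendsto (tendsto_finsetSum S fun k _ => (ha t k ht).norm.pow 2) ?_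
    filter_upwards [up (mem t ht)] with N hN
    exact sum_le_of_forall_Icc (fun k => by positivity)
      (fun k hk => by simp [(hg N).support t k hk]) ((hg N).apriori hQ hKQ (hcN N) hN).2 S
  · refine le_of_tendsto (tendsto_finsetSum S fun k _ => ((ha t k ht).norm.pow 2).const_mul _) ?_
    filter_upwards [up (mem t ht)] with N hN
    refine sum_le_of_forall_Icc (fun k => mul_nonneg (sobWeight_nonneg hn _) (by positivity))
      (fun k hk => by simp [(hg N).support t k hk])
      (((hg N).weighted_energy_le hQ hKQ (hcN N) hn hN).trans ?_) S
    gcongr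
    refine Summable.sum_le_tsum _ (fun k _ => nonneg n hn k) ?_
    exact .of_nonneg_of_le (nonneg n hn) (fun k => by gcongr; exact sobWeight_le_one_intCast n k)
      hsum

/-! ### Fourier integrals of the logarithmic kernel -/

lemma integral_cos_two_mul_nat {m : ℕ} (hm : m ≠ 0) :
    ∫ x in (0 : ℝ)..Real.pi, Real.cos (2 * m * x) = 0 := by
  have hm' : (2 * m : ℝ) ≠ 0 := by positivity
  rw [intervalIntegral.integral_comp_mul_left (fun x => Real.cos x) hm', integral_cos]
  have : Real.sin (2 * m * Real.pi) = 0 := by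
    have := Real.sin_nat_mul_pi (2 * m)
    push_cast at this
    exact this
  simp [this]

/-- The quotient `sin (2 (k + 1) x) / sin x` is a trigonometric polynomial. -/
lemma exists_mul_sin_eq (k : ℕ) : ∃ D : ℝ → ℝ, Continuous D ∧
    (∀ x, D x * Real.sin x = Real.sin (2 * (k + 1 : ℕ) * x)) ∧
    ∫ x in (0 : ℝ)..Real.pi, D x * Real.cos x = Real.pi := by
  induction k with
  | zero =>
    refine ⟨fun x => 2 * Real.cos x, by fun_prop, fun x => ?_, ?_⟩
    · simp only [zero_add, Nat.cast_one, mul_one, Real.sin_two_mul]; ring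
    · have e : ∀ x : ℝ, 2 * Real.cos x * Real.cos x = 1 + Real.cos (2 * (1 : ℕ) * x) := fun x => by
        rw [Nat.cast_one, mul_one, Real.cos_two_mul]; ring
      simp_rw [e]
      rw [intervalIntegral.integral_add (by simp)
        ((by fun_prop : Continuous _).intervalIntegrable _ _),
        integral_cos_two_mul_nat one_ne_zero]
      simp
  | succ k ih =>
    obtain ⟨D, hD, hs, hi⟩ := ih
    -- `sin ((2k+4)x) - sin ((2k+2)x) = 2 cos ((2k+3)x) sin x`.
    refine ⟨fun x => D x + 2 * Real.cos ((2 * k + 3) * x), by fun_prop, fun x => ?_, ?_⟩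
    · rw [add_mul, hs]
      have h1 : (2 * (k + 1 : ℕ) * x : ℝ) = (2 * k + 3) * x - x := by push_cast; ring
      have h2 : (2 * (k + 1 + 1 : ℕ) * x : ℝ) = (2 * k + 3) * x + x := by push_cast; ring
      rw [h1, h2, Real.sin_add, Real.sin_sub]; ring
    · have e : ∀ x : ℝ, (D x + 2 * Real.cos ((2 * k + 3) * x)) * Real.cos x = D x * Real.cos x +
          (Real.cos (2 * (k + 1 + 1 : ℕ) * x) + Real.cos (2 * (k + 1 : ℕ) * x)) := fun x => by
        have h1 : (2 * (k + 1 : ℕ) * x : ℝ) = (2 * k + 3) * x - x := by push_cast; ring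
        have h2 : (2 * (k + 1 + 1 : ℕ) * x : ℝ) = (2 * k + 3) * x + x := by push_cast; ring
        rw [h1, h2, Real.cos_add, Real.cos_sub]; ring
      simp_rw [e]
      rw [intervalIntegral.integral_add ((by fun_prop : Continuous _).intervalIntegrable _ _)
        ((by fun_prop : Continuous _).intervalIntegrable _ _),
        intervalIntegral.integral_add ((by fun_prop : Continuous _).intervalIntegrable _ _)
        ((by fun_prop : Continuous _).intervalIntegrable _ _), hi,
        integral_cos_two_mul_nat (by omega), integral_cos_two_mul_nat (by omega)]
      simp

/-- Integration by parts against `sin (m x) * log (sin x)`. Written as `D * (sin * log sin)` it is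
continuous up to the endpoints and vanishes there; the remaining term is `D x * cos x`. -/
lemma integral_log_sin_mul_cos (k : ℕ) :
    ∫ x in (0 : ℝ)..Real.pi, Real.log (Real.sin x) * Real.cos (2 * (k + 1 : ℕ) * x) =
      -(Real.pi / (2 * (k + 1 : ℕ))) := by
  obtain ⟨D, hD, hs, hi⟩ := exists_mul_sin_eq k
  set m : ℝ := 2 * (k + 1 : ℕ) with hm
  have hm0 : 0 < m := by rw [hm]; positivity
  have hlog : IntervalIntegrable (fun x => Real.log (Real.sin x)) volume 0 Real.pi :=
    intervalIntegrable_log_sin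
  have i1 : IntervalIntegrable (fun x => m * (Real.log (Real.sin x) * Real.cos (m * x)))
      volume 0 Real.pi :=
    (hlog.mul_continuousOn (by fun_prop : Continuous _).continuousOn).const_mul m
  have i2 : IntervalIntegrable (fun x => D x * Real.cos x) volume 0 Real.pi :=
    (by fun_prop : Continuous _).intervalIntegrable _ _
  have hF : Continuous fun x => D x * (Real.sin x * Real.log (Real.sin x)) :=
    hD.mul (Real.continuous_mul_log.comp Real.continuous_sin)
  have ftc := intervalIntegral.integral_eq_sub_of_hasDerivAt_of_le Real.pi_pos.le hF.continuousOn
    (f' := fun x => m * (Real.log (Real.sin x) * Real.cos (m * x)) + D x * Real.cos x)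
    (fun x hx => ?_) (i1.add i2)
  · rw [intervalIntegral.integral_add i1 i2, hi, intervalIntegral.integral_const_mul] at ftc
    simp only [Real.sin_pi, Real.sin_zero, zero_mul, mul_zero, sub_zero] at ftc
    field_simp
    linarith
  · have hx0 : Real.sin x ≠ 0 := (Real.sin_pos_of_mem_Ioo hx).ne'
    have e : (fun x => D x * (Real.sin x * Real.log (Real.sin x))) =
        fun x => Real.sin (m * x) * Real.log (Real.sin x) := by
      funext y; rw [← mul_assoc, hs]
    rw [e]
    have h1 : HasDerivAt (fun x => Real.sin (m * x)) (Real.cos (m * x) * m) x := by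
      simpa using ((hasDerivAt_id x).const_mul m).sin
    refine (h1.mul ((Real.hasDerivAt_sin x).log hx0)).congr_deriv ?_
    rw [← hs x]
    field_simp

/-- The logarithmic kernel of `Λ⁻¹`. -/
noncomputable def logKernel (x : ℝ) : ℝ := Real.log (4 * Real.sin (x / 2) ^ 2)

lemma logKernel_periodic : Function.Periodic logKernel (2 * Real.pi) := fun x => by
  simp [logKernel, add_div, mul_div_cancel_left₀]

lemma logKernel_two_mul {x : ℝ} (hx : Real.sin x ≠ 0) :
    logKernel (2 * x) = Real.log 4 + 2 * Real.log (Real.sin x) := by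
  rw [logKernel, mul_div_cancel_left₀ _ two_ne_zero, Real.log_mul (by norm_num) (by positivity),
    Real.log_pow]
  norm_num

lemma logKernel_ae_eq : (fun x => logKernel (2 * x)) =ᵐ[volume.restrict (Set.uIoc 0 Real.pi)]
    fun x => Real.log 4 + 2 * Real.log (Real.sin x) := by
  rw [Set.uIoc_of_le Real.pi_pos.le, Filter.EventuallyEq, ae_restrict_iff' measurableSet_Ioc]
  filter_upwards [compl_mem_ae_iff.2 (measure_singleton Real.pi)] with x hx hx2
  exact logKernel_two_mul (Real.sin_pos_of_mem_Ioo ⟨hx2.1, lt_of_le_of_ne hx2.2 hx⟩).ne'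

lemma intervalIntegrable_logKernel_two_mul :
    IntervalIntegrable (fun x => logKernel (2 * x)) volume 0 Real.pi := by
  have : IntervalIntegrable (fun x => Real.log 4 + 2 * Real.log (Real.sin x)) volume 0 Real.pi :=
    (by simp : IntervalIntegrable (fun _ => Real.log 4) volume 0 Real.pi).add
      (IntervalIntegrable.const_mul intervalIntegrable_log_sin 2)
  exact this.congr_ae logKernel_ae_eq.symm

lemma intervalIntegrable_logKernel : IntervalIntegrable logKernel volume 0 (2 * Real.pi) := by
  have := intervalIntegrable_logKernel_two_mul.comp_mul_left (c := 1 / 2)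
  have e : ∀ x : ℝ, 2 * (x * 2⁻¹) = x := fun x => by ring
  simpa [mul_comm, e] using this

lemma integral_logKernel_mul_cos (k : ℕ) :
    ∫ x in (0 : ℝ)..Real.pi, logKernel (2 * x) * Real.cos (2 * k * x) = -(Real.pi / k) := by
  have e : ∫ x in (0 : ℝ)..Real.pi, logKernel (2 * x) * Real.cos (2 * k * x) =
      ∫ x in (0 : ℝ)..Real.pi, (Real.log 4 * Real.cos (2 * k * x) +
        2 * (Real.log (Real.sin x) * Real.cos (2 * k * x))) := by
    refine intervalIntegral.integral_congr_ae_restrict ?_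
    filter_upwards [logKernel_ae_eq] with x hx
    rw [hx]; ring
  have i1 : IntervalIntegrable (fun x => Real.log (Real.sin x) * Real.cos (2 * k * x))
      volume 0 Real.pi :=
    IntervalIntegrable.mul_continuousOn intervalIntegrable_log_sin
      (by fun_prop : Continuous _).continuousOn
  rw [e, intervalIntegral.integral_add ((by fun_prop : Continuous _).intervalIntegrable _ _)
    (i1.const_mul 2), intervalIntegral.integral_const_mul, intervalIntegral.integral_const_mul]
  -- For `k = 0` the right side is zero by the convention on division by zero, and the kernel indeed
  -- has mean zero.
  rcases k with _ | k
  · have h4 : Real.log 4 = 2 * Real.log 2 := by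
      rw [show (4 : ℝ) = 2 ^ 2 by norm_num, Real.log_pow]; norm_num
    simp [integral_log_sin_zero_pi, h4]
    ring
  · rw [integral_cos_two_mul_nat (by omega), integral_log_sin_mul_cos]
    field_simp
    ring

/-- The integrand is odd about `π / 2`. -/
lemma integral_logKernel_mul_sin (k : ℕ) :
    ∫ x in (0 : ℝ)..Real.pi, logKernel (2 * x) * Real.sin (2 * k * x) = 0 := by
  have h := intervalIntegral.integral_comp_sub_left (a := 0) (b := Real.pi)
    (fun x => logKernel (2 * x) * Real.sin (2 * k * x)) Real.pi
  have e : ∀ x : ℝ, logKernel (2 * (Real.pi - x)) * Real.sin (2 * k * (Real.pi - x)) =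
      -(logKernel (2 * x) * Real.sin (2 * k * x)) := fun x => by
    have h1 : logKernel (2 * (Real.pi - x)) = logKernel (2 * x) := by
      simp [logKernel, mul_div_cancel_left₀]
    have h2 : Real.sin (2 * k * (Real.pi - x)) = -Real.sin (2 * k * x) := by
      rw [show 2 * k * (Real.pi - x) = k * (2 * Real.pi) - 2 * k * x by ring,
        Real.sin_nat_mul_two_pi_sub]
    rw [h1, h2, mul_neg]
  simp only [e, intervalIntegral.integral_neg, sub_self, sub_zero] at h
  linarith

lemma integral_logKernel_mul_exp_nat (k : ℕ) {σ : ℝ} (hσ : σ ^ 2 = 1) :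
    ∫ x in (0 : ℝ)..2 * Real.pi, (logKernel x : ℂ) * Complex.exp (σ * Complex.I * k * x) =
      ((-(2 * Real.pi / k) : ℝ) : ℂ) := by
  have h := intervalIntegral.integral_comp_mul_left (a := 0) (b := Real.pi)
    (fun x : ℝ => (logKernel x : ℂ) * Complex.exp (σ * Complex.I * k * x)) (two_ne_zero' ℝ)
  rw [mul_zero] at h
  have hc : ∀ x : ℝ, Real.cos (σ * (2 * k * x)) = Real.cos (2 * k * x) ∧
      Real.sin (σ * (2 * k * x)) = σ * Real.sin (2 * k * x) := fun x => by
    rw [sq] at hσ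
    rcases mul_self_eq_one_iff.1 hσ with rfl | rfl <;> simp
  have e : ∀ x : ℝ, (logKernel (2 * x) : ℂ) * Complex.exp (σ * Complex.I * k * (2 * x : ℝ)) =
      ((logKernel (2 * x) * Real.cos (2 * k * x) : ℝ) : ℂ) +
        σ * Complex.I * ((logKernel (2 * x) * Real.sin (2 * k * x) : ℝ) : ℂ) := fun x => by
    have : (σ * Complex.I * k * (2 * x : ℝ) : ℂ) = ((σ * (2 * k * x) : ℝ) : ℂ) * Complex.I := by
      push_cast; ring
    rw [this, Complex.exp_mul_I, ← Complex.ofReal_cos, ← Complex.ofReal_sin, (hc x).1, (hc x).2]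
    push_cast; ring
  have i1 : IntervalIntegrable (fun x => logKernel (2 * x) * Real.cos (2 * k * x)) volume 0 Real.pi :=
    intervalIntegrable_logKernel_two_mul.mul_continuousOn (by fun_prop : Continuous _).continuousOn
  have i2 : IntervalIntegrable (fun x => logKernel (2 * x) * Real.sin (2 * k * x)) volume 0 Real.pi :=
    intervalIntegrable_logKernel_two_mul.mul_continuousOn (by fun_prop : Continuous _).continuousOn
  have i1' : IntervalIntegrable (fun x => ((logKernel (2 * x) * Real.cos (2 * k * x) : ℝ) : ℂ))
      volume 0 Real.pi := ⟨i1.1.ofReal, i1.2.ofReal⟩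
  have i2' : IntervalIntegrable (fun x => ((logKernel (2 * x) * Real.sin (2 * k * x) : ℝ) : ℂ))
      volume 0 Real.pi := ⟨i2.1.ofReal, i2.2.ofReal⟩
  simp_rw [e] at h
  rw [intervalIntegral.integral_add i1' (i2'.const_mul _),
    intervalIntegral.integral_const_mul, intervalIntegral.integral_ofReal,
    intervalIntegral.integral_ofReal, integral_logKernel_mul_cos, integral_logKernel_mul_sin] at h
  rw [Complex.ofReal_zero, mul_zero, add_zero, eq_inv_smul_iff₀ two_ne_zero] at h
  rw [← h, Complex.real_smul]
  push_cast
  ring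

/-! ### Absolutely convergent Fourier series -/

lemma norm_fourier_apply (k : ℤ) (x : Torus) : ‖fourier k x‖ = 1 := by
  rw [fourier_apply, Circle.norm_coe]

lemma fourier_two_pi (k : ℤ) (x : ℝ) : fourier k (x : Torus) = Complex.exp (Complex.I * k * x) := by
  rw [fourier_coe_apply]
  congr 1
  have : (Real.pi : ℂ) ≠ 0 := by exact_mod_cast Real.pi_ne_zero
  push_cast
  field_simp

/-- The sum of the Fourier series with coefficients `b`. -/
noncomputable def fourierSum (b : ℤ → ℂ) (x : Torus) : ℂ := ∑' k, b k * fourier k x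

/-- The real part of the sum of a Fourier series. -/
noncomputable def realFourierSum (b : ℤ → ℂ) (x : Torus) : ℝ := (fourierSum b x).re

section fourierSum

variable {b : ℤ → ℂ}

lemma summable_fourierSum (hb : Summable fun k => ‖b k‖) (x : Torus) :
    Summable fun k => ‖b k * fourier k x‖ := by
  simpa only [norm_mul, norm_fourier_apply, mul_one] using hb

lemma hasSum_fourierSum (hb : Summable fun k => ‖b k‖) (x : Torus) :
    HasSum (fun k => b k * fourier k x) (fourierSum b x) :=
  (summable_fourierSum hb x).of_norm.hasSum

lemma ofReal_realFourierSum (hn : ∀ k, b (-k) = star (b k)) (x : Torus) :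
    (realFourierSum b x : ℂ) = fourierSum b x := by
  refine Complex.conj_eq_iff_re.1 ?_
  rw [fourierSum, Complex.conj_tsum, ← (Equiv.neg ℤ).tsum_eq]
  refine tsum_congr fun k => ?_
  rw [Equiv.neg_apply, hn, map_mul, Complex.star_def, Complex.conj_conj, fourier_neg,
    Complex.conj_conj]

lemma continuous_fourierSum (hb : Summable fun k => ‖b k‖) : Continuous (fourierSum b) :=
  continuous_tsum (fun k => continuous_const.mul (map_continuous (fourier k))) hb fun k x => by
    rw [norm_mul, norm_fourier_apply, mul_one]

lemma continuous_realFourierSum (hb : Summable fun k => ‖b k‖) : Continuous (realFourierSum b) :=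
  Complex.continuous_re.comp (continuous_fourierSum hb)

lemma fourierCoeff_fourierSum (hb : Summable fun k => ‖b k‖) (n : ℤ) :
    fourierCoeff (fourierSum b) n = b n := by
  have hi : ∀ k, Integrable (fun x : Torus => fourier (-n) x • (b k * fourier k x))
      AddCircle.haarAddCircle := fun k =>
    Continuous.integrable_of_hasCompactSupport
      ((map_continuous (fourier (-n))).smul (continuous_const.mul (map_continuous (fourier k))))
      (HasCompactSupport.of_compactSpace _)
  have hnorm : ∀ k (x : Torus), ‖fourier (-n) x • (b k * fourier k x)‖ = ‖b k‖ := fun k x => by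
    rw [norm_smul, norm_mul, norm_fourier_apply, norm_fourier_apply, one_mul, mul_one]
  have h := hasSum_integral_of_summable_integral_norm hi (by simp only [hnorm]; simpa using hb)
  have hk : ∀ k, ∫ x : Torus, fourier (-n) x • (b k * fourier k x) ∂AddCircle.haarAddCircle =
      b k * (Pi.single k (1 : ℂ) : ℤ → ℂ) n := fun k => by
    have := congrFun (fourierCoeff_fourier (T := 2 * Real.pi) k) n
    rw [← this, ← fourierCoeff.const_mul]
    rfl
  simp_rw [hk] at h
  have h2 : HasSum (fun k => b k * (Pi.single k (1 : ℂ) : ℤ → ℂ) n) (b n) := by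
    have := hasSum_single (f := fun k => b k * (Pi.single k (1 : ℂ) : ℤ → ℂ) n) n
      fun k hk => by simp [hk.symm]
    simpa using this
  rw [← h.unique h2]
  have e : ∀ x : Torus, ∑' k, fourier (-n) x • (b k * fourier k x) =
      fourier (-n) x • fourierSum b x := fun x => by
    simp only [smul_eq_mul, fourierSum, tsum_mul_left]
  simp_rw [e]
  rfl

lemma hat_realFourierSum (hb : Summable fun k => ‖b k‖) (hn : ∀ k, b (-k) = star (b k)) (n : ℤ) :
    hat (realFourierSum b) n = b n := by
  simp only [hat, ofReal_realFourierSum hn]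
  exact fourierCoeff_fourierSum hb n

lemma memLp_realFourierSum (hb : Summable fun k => ‖b k‖) :
    MemLp (realFourierSum b) 2 volume :=
  (continuous_realFourierSum hb).memLp_of_hasCompactSupport (HasCompactSupport.of_compactSpace _)

lemma hasDerivAt_fourierSum (hb : Summable fun k => ‖b k‖)
    (hb' : Summable fun k : ℤ => ‖Complex.I * k * b k‖) (α : ℝ) :
    HasDerivAt (fun x : ℝ => fourierSum b (x : Torus))
      (fourierSum (fun k => Complex.I * k * b k) (α : Torus)) α := by
  have h := hasDerivAt_tsum (u := fun k : ℤ => ‖Complex.I * k * b k‖)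
    (g := fun k (x : ℝ) => b k * fourier k (x : Torus))
    (g' := fun k (x : ℝ) => Complex.I * k * b k * fourier k (x : Torus)) (y₀ := 0) hb'
    (fun k x => ?_) (fun k x => ?_) (summable_fourierSum hb _).of_norm α
  · exact h
  · refine ((hasDerivAt_fourier (2 * Real.pi) k x).const_mul (b k)).congr_deriv ?_
    have : (Real.pi : ℂ) ≠ 0 := by exact_mod_cast Real.pi_ne_zero
    push_cast
    field_simp
  · rw [norm_mul, norm_fourier_apply, mul_one]

lemma hasDerivAt_realFourierSum (hb : Summable fun k => ‖b k‖)
    (hb' : Summable fun k : ℤ => ‖Complex.I * k * b k‖) (α : ℝ) :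
    HasDerivAt (fun x : ℝ => realFourierSum b (x : Torus))
      (realFourierSum (fun k => Complex.I * k * b k) (α : Torus)) α :=
  Complex.reCLM.hasFDerivAt.comp_hasDerivAt α (hasDerivAt_fourierSum hb hb' α)

lemma fourierSum_mul {a : ℤ → ℂ} (ha : Summable fun k => ‖a k‖) (hb : Summable fun k => ‖b k‖)
    (x : Torus) :
    fourierSum a x * fourierSum b x = fourierSum (fun k => ∑' j, a j * b (k - j)) x := by
  have hs := summable_mul_of_summable_norm (summable_fourierSum ha x) (summable_fourierSum hb x)
  let e : ℤ × ℤ ≃ ℤ × ℤ :=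
    { toFun := fun p => (p.2, p.1 - p.2)
      invFun := fun q => (q.1 + q.2, q.1)
      left_inv := fun p => by simp
      right_inv := fun q => by simp }
  have hs' : Summable fun p : ℤ × ℤ => a (e p).1 * fourier (e p).1 x *
      (b (e p).2 * fourier (e p).2 x) := e.summable_iff.2 hs
  rw [fourierSum, fourierSum, tsum_mul_tsum_of_summable_norm (summable_fourierSum ha x)
    (summable_fourierSum hb x), ← e.tsum_eq, Summable.tsum_prod hs', fourierSum]
  refine tsum_congr fun k => ?_
  rw [← tsum_mul_right]
  refine tsum_congr fun j => ?_
  have : (fourier k x : ℂ) = fourier j x * fourier (k - j) x := by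
    rw [← fourier_add, add_sub_cancel]
  rw [this]
  change a j * fourier j x * (b (k - j) * fourier (k - j) x) = _
  ring

lemma fourierSum_sub {a : ℤ → ℂ} (ha : Summable fun k => ‖a k‖) (hb : Summable fun k => ‖b k‖)
    (x : Torus) : fourierSum a x - fourierSum b x = fourierSum (fun k => a k - b k) x := by
  rw [fourierSum, fourierSum, ← (summable_fourierSum ha x).of_norm.tsum_sub
    (summable_fourierSum hb x).of_norm, fourierSum]
  exact tsum_congr fun k => by ring

lemma integral_logKernel_mul_exp (k : ℤ) :
    ∫ x in (0 : ℝ)..2 * Real.pi, (logKernel x : ℂ) * Complex.exp (-(Complex.I * k * x)) =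
      ((-(2 * Real.pi / |(k : ℝ)|) : ℝ) : ℂ) := by
  obtain ⟨m, rfl | rfl⟩ := Int.eq_nat_or_neg k
  · have := integral_logKernel_mul_exp_nat m (σ := -1) (by norm_num)
    simpa using this
  · have := integral_logKernel_mul_exp_nat m (σ := 1) (by norm_num)
    simpa using this

/-- By periodicity `Λ⁻¹` is convolution with `logKernel`, integrated term by term under the majorant
`‖b k‖ * |logKernel|`. The mode `k = 0` is annihilated on both sides. -/
lemma invLambda_realFourierSum (hb : Summable fun k => ‖b k‖) (hn : ∀ k, b (-k) = star (b k))
    (α : ℝ) : (invLambda (realFourierSum b) α : ℂ) =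
      fourierSum (fun k : ℤ => b k / ((|(k : ℝ)| : ℝ) : ℂ)) (α : Torus) := by
  have per : Function.Periodic
      (fun γ : ℝ => logKernel γ * realFourierSum b ((α - γ : ℝ) : Torus)) (2 * Real.pi) := fun γ => by
    have h2 : ((α - (γ + 2 * Real.pi) : ℝ) : Torus) = ((α - γ : ℝ) : Torus) := by
      rw [← sub_sub, AddCircle.coe_sub (2 * Real.pi) (α - γ), AddCircle.coe_period, sub_zero]
    simp only [logKernel_periodic γ, h2]
  have shift : ∫ β in (-Real.pi)..Real.pi,
      Real.log (4 * Real.sin ((α - β) / 2) ^ 2) * realFourierSum b (β : Torus) =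
      ∫ γ in (0 : ℝ)..2 * Real.pi, logKernel γ * realFourierSum b ((α - γ : ℝ) : Torus) := by
    have h1 := intervalIntegral.integral_comp_sub_left (a := -Real.pi) (b := Real.pi)
      (fun γ : ℝ => logKernel γ * realFourierSum b ((α - γ : ℝ) : Torus)) α
    simp only [sub_sub_cancel] at h1
    have h2 := per.intervalIntegral_add_eq (α - Real.pi) 0
    rw [show α - Real.pi + 2 * Real.pi = α - -Real.pi by ring, zero_add] at h2
    rw [← h2, ← h1]
    rfl
  have meas : AEStronglyMeasurable logKernel (volume.restrict (Set.uIoc 0 (2 * Real.pi))) :=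
    intervalIntegrable_logKernel.def'.aestronglyMeasurable
  have hterm : ∀ (k : ℤ) (γ : ℝ), ‖(logKernel γ : ℂ) * (b k * fourier k ((α - γ : ℝ) : Torus))‖ =
      ‖b k‖ * |logKernel γ| := fun k γ => by
    rw [norm_mul, norm_mul, norm_fourier_apply, mul_one, Complex.norm_real, Real.norm_eq_abs,
      mul_comm]
  have hint := intervalIntegral.hasSum_integral_of_dominated_convergence (μ := volume)
    (a := 0) (b := 2 * Real.pi)
    (F := fun (k : ℤ) (γ : ℝ) => (logKernel γ : ℂ) * (b k * fourier k ((α - γ : ℝ) : Torus)))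
    (f := fun γ => (logKernel γ : ℂ) * fourierSum b ((α - γ : ℝ) : Torus))
    (fun k γ => ‖b k‖ * |logKernel γ|) (fun k => ?_)
    (fun k => ae_of_all _ fun γ _ => (hterm k γ).le)
    (ae_of_all _ fun γ _ => hb.mul_right _) ?_
    (ae_of_all _ fun γ _ => (hasSum_fourierSum hb _).mul_left _)
  · have hk : ∀ k : ℤ, ∫ γ in (0 : ℝ)..2 * Real.pi,
        (logKernel γ : ℂ) * (b k * fourier k ((α - γ : ℝ) : Torus)) =
        (-(2 * Real.pi) : ℂ) * (b k / ((|(k : ℝ)| : ℝ) : ℂ) * fourier k (α : Torus)) := fun k => by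
      have e : ∀ γ : ℝ, (logKernel γ : ℂ) * (b k * fourier k ((α - γ : ℝ) : Torus)) =
          b k * fourier k (α : Torus) *
            ((logKernel γ : ℂ) * Complex.exp (-(Complex.I * k * γ))) := fun γ => by
        rw [fourier_two_pi, fourier_two_pi, show Complex.I * k * ((α - γ : ℝ) : ℂ) =
          Complex.I * k * α + -(Complex.I * k * γ) by push_cast; ring, Complex.exp_add]
        ring
      simp_rw [e]
      rw [intervalIntegral.integral_const_mul, integral_logKernel_mul_exp]
      push_cast
      ring
    simp_rw [hk] at hint
    have hre : ∫ γ in (0 : ℝ)..2 * Real.pi,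
        (logKernel γ : ℂ) * fourierSum b ((α - γ : ℝ) : Torus) =
        ((∫ γ in (0 : ℝ)..2 * Real.pi,
          logKernel γ * realFourierSum b ((α - γ : ℝ) : Torus) : ℝ) : ℂ) := by
      rw [← intervalIntegral.integral_ofReal]
      refine intervalIntegral.integral_congr fun γ _ => ?_
      simp only [Complex.ofReal_mul, ofReal_realFourierSum hn]
    rw [hre] at hint
    rw [invLambda, shift, Complex.ofReal_mul, ← hint.tsum_eq, tsum_mul_left, fourierSum]
    have : (Real.pi : ℂ) ≠ 0 := by exact_mod_cast Real.pi_ne_zero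
    push_cast
    field_simp
  · refine (Complex.continuous_ofReal.comp_aestronglyMeasurable meas).mul ?_
    exact Continuous.aestronglyMeasurable (continuous_const.mul
      ((map_continuous (fourier k)).comp ((AddCircle.continuous_mk' _).comp
        (continuous_const.sub continuous_id))))
  · simp_rw [tsum_mul_right]
    exact intervalIntegrable_logKernel.abs.const_mul _

lemma tsum_norm_sq_eq_integral (hb : Summable fun k => ‖b k‖) :
    ∑' k, ‖b k‖ ^ 2 = ∫ t, ‖fourierSum b t‖ ^ 2 ∂AddCircle.haarAddCircle := by
  have hF : MemLp (fourierSum b) 2 (AddCircle.haarAddCircle (T := 2 * Real.pi)) :=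
    (continuous_fourierSum hb).memLp_of_hasCompactSupport (HasCompactSupport.of_compactSpace _)
  have hp := tsum_sq_fourierCoeff hF.toLp
  have hc : ∀ k, fourierCoeff (hF.toLp : Torus → ℂ) k = b k := fun k => by
    rw [fourierCoeff_congr_ae hF.coeFn_toLp, fourierCoeff_fourierSum hb]
  simp only [hc] at hp
  rw [hp]
  refine integral_congr_ae ?_
  filter_upwards [hF.coeFn_toLp] with t ht
  rw [ht]

lemma integral_norm_rpow_realFourierSum (hb : Summable fun k => ‖b k‖)
    (hn : ∀ k, b (-k) = star (b k)) :
    ∫ t, ‖realFourierSum b t‖ ^ (2 : ℝ) = 2 * Real.pi * ∑' k, ‖b k‖ ^ 2 := by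
  rw [tsum_norm_sq_eq_integral hb, AddCircle.integral_haarAddCircle, smul_eq_mul,
    mul_inv_cancel_left₀ Real.two_pi_pos.ne']
  refine integral_congr_ae (ae_of_all _ fun t => ?_)
  simp only [← ofReal_realFourierSum hn, Complex.norm_real, Real.rpow_ofNat]

lemma eLpNorm_realFourierSum (hb : Summable fun k => ‖b k‖) (hn : ∀ k, b (-k) = star (b k)) :
    eLpNorm (realFourierSum b) 2 volume =
      ENNReal.ofReal (√(2 * Real.pi * ∑' k, ‖b k‖ ^ 2)) := by
  have h := (memLp_realFourierSum hb).eLpNorm_eq_integral_rpow_norm two_ne_zero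
    ENNReal.ofNat_ne_top
  rw [ENNReal.toReal_ofNat, integral_norm_rpow_realFourierSum hb hn] at h
  rw [h, Real.sqrt_eq_rpow, one_div]

end fourierSum

/-! ### From coefficients to the equation -/

lemma ae_eq_of_hat_eq {f g : Torus → ℝ} (hf : MemLp f 2 volume) (hg : MemLp g 2 volume)
    (h : ∀ k, hat f k = hat g k) : f =ᵐ[volume] g := by
  have hf' : MemLp (fun x => (f x : ℂ)) 2 AddCircle.haarAddCircle := hf.ofReal.haarAddCircle
  have hg' : MemLp (fun x => (g x : ℂ)) 2 AddCircle.haarAddCircle := hg.ofReal.haarAddCircle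
  have e : hf'.toLp = hg'.toLp := by
    apply (fourierBasis (T := 2 * Real.pi)).repr.injective
    ext k
    rw [fourierBasis_repr, fourierBasis_repr, fourierCoeff_congr_ae hf'.coeFn_toLp,
      fourierCoeff_congr_ae hg'.coeFn_toLp]
    exact h k
  have h1 : (fun x => (f x : ℂ)) =ᵐ[AddCircle.haarAddCircle] fun x => (g x : ℂ) :=
    hf'.coeFn_toLp.symm.trans ((Filter.EventuallyEq.of_eq (by rw [e])).trans hg'.coeFn_toLp)
  rw [AddCircle.volume_eq_smul_haarAddCircle]
  refine (Measure.smul_absolutelyContinuous (c := ENNReal.ofReal (2 * Real.pi))).ae_le ?_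
  filter_upwards [h1] with x hx
  exact_mod_cast hx

lemma hat_neg (f : Torus → ℝ) (k : ℤ) : hat f (-k) = star (hat f k) := by
  rw [hat, hat, fourierCoeff, fourierCoeff, Complex.star_def, ← integral_conj]
  refine integral_congr_ae (ae_of_all _ fun x => ?_)
  simp [fourier_neg, -fourier_apply]

lemma hat_zero (f : Torus → ℝ) (hf : ∫ α : Torus, f α = 0) : hat f 0 = 0 := by
  have : ∫ α : Torus, (f α : ℂ) = 0 := by
    rw [integral_complex_ofReal, hf, Complex.ofReal_zero]
  simp [hat, fourierCoeff, AddCircle.integral_haarAddCircle, this]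

lemma HasDecay.summable {s : ℕ} {A : ℝ} {b : ℤ → ℂ} (hb : HasDecay s A b) (hs : 2 ≤ s) :
    Summable fun k => ‖b k‖ :=
  .of_nonneg_of_le (fun _ => norm_nonneg _) (fun k => (hb.mono hs k).trans_eq (by ring))
    (summable_bracket.mul_left A)

lemma HasDecay.I_mul {s : ℕ} {A : ℝ} {b : ℤ → ℂ} (hb : HasDecay (s + 1) A b) :
    HasDecay s A fun k => Complex.I * k * b k := fun k => by
  have h0 := abs_nonneg (k : ℝ)
  have hA := hb.const_nonneg
  rw [norm_mul, norm_mul, Complex.norm_I, one_mul, Complex.norm_intCast]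
  calc |(k : ℝ)| * ‖b k‖ ≤ (1 + |(k : ℝ)|) * (A / (1 + |(k : ℝ)|) ^ (s + 1)) := by
        gcongr
        · linarith
        · exact hb k
    _ = _ := by field_simp; ring

lemma HasDecay.div_abs {s : ℕ} {A : ℝ} {b : ℤ → ℂ} (hb : HasDecay s A b) :
    HasDecay s A fun k : ℤ => b k / ((|(k : ℝ)| : ℝ) : ℂ) := fun k =>
  (norm_div_abs_le _ _).trans (hb k)

lemma neg_I_mul {b : ℤ → ℂ} (hn : ∀ k, b (-k) = star (b k)) (k : ℤ) :
    Complex.I * ((-k : ℤ) : ℂ) * b (-k) = star (Complex.I * k * b k) := by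
  simp [hn]

/-- The coefficients of `u u_α` are those of `(u² / 2)_α`. -/
lemma tsum_mul_I_mul {A : ℝ} {a : ℤ → ℂ} (ha : HasDecay 4 A a) (k : ℤ) :
    ∑' j, a j * (Complex.I * ((k - j : ℤ) : ℂ) * a (k - j)) =
      Complex.I * k / 2 * ∑' j, a j * a (k - j) := by
  have ha3 := ha.mono (by norm_num : 3 ≤ 4)
  have s1 := ha3.summable_mul (by norm_num) ha.I_mul k
  have s2 := ha.I_mul.summable_mul (by norm_num) ha3 k
  have e : ∑' j, a j * (Complex.I * ((k - j : ℤ) : ℂ) * a (k - j)) =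
      ∑' j, Complex.I * j * a j * a (k - j) := by
    rw [← (Equiv.subLeft k).tsum_eq]
    refine tsum_congr fun j => ?_
    simp only [Equiv.subLeft_apply, sub_sub_cancel]
    ring
  -- Averaging over `j ↔ k - j` replaces the factor `k - j` by `k / 2`.
  have h2 : 2 * ∑' j, a j * (Complex.I * ((k - j : ℤ) : ℂ) * a (k - j)) =
      Complex.I * k * ∑' j, a j * a (k - j) := by
    rw [two_mul]
    nth_rw 2 [e]
    rw [← s1.tsum_add s2, ← tsum_mul_left]
    refine tsum_congr fun j => ?_
    push_cast
    ring
  linear_combination h2 / 2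

lemma burgers_identity {A : ℝ} {a : ℤ → ℂ} (ha : HasDecay 4 A a) (hn : ∀ k, a (-k) = star (a k))
    (α : ℝ) : realFourierSum (burgersField a) (α : Torus) +
      realFourierSum a (α : Torus) * realFourierSum (fun k => Complex.I * k * a k) (α : Torus) =
      -invLambda (realFourierSum a) α := by
  have hs := ha.summable (by norm_num)
  have hI := (ha.I_mul).summable (by norm_num)
  apply Complex.ofReal_injective
  rw [Complex.ofReal_add, Complex.ofReal_mul, Complex.ofReal_neg, invLambda_realFourierSum hs hn,
    ofReal_realFourierSum hn, ofReal_realFourierSum (burgersField_neg hn),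
    ofReal_realFourierSum (neg_I_mul hn), fourierSum_mul hs hI]
  have hB := hasSum_fourierSum (ha.burgersField.summable (by norm_num)) (α : Torus)
  have hL := hasSum_fourierSum (ha.div_abs.summable (by norm_num)) (α : Torus)
  have hsum := (hB.add hL).neg.tsum_eq
  have e : fourierSum (fun k => ∑' j, a j * (Complex.I * ((k - j : ℤ) : ℂ) * a (k - j)))
      (α : Torus) = ∑' k, -(burgersField a k * fourier k (α : Torus) +
        a k / ((|(k : ℝ)| : ℝ) : ℂ) * fourier k (α : Torus)) := by
    refine tsum_congr fun k => ?_
    simp only [tsum_mul_I_mul ha, burgersField]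
    ring
  rw [e, hsum]
  ring

/-! ### The solution in physical space -/

lemma hasDerivWithinAt_of_quadratic {E : Type*} [NormedAddCommGroup E] [NormedSpace ℝ E]
    {f : ℝ → E} {f' : E} {s : Set ℝ} {t C : ℝ}
    (h : ∀ τ ∈ s, ‖f τ - f t - (τ - t) • f'‖ ≤ C * (τ - t) ^ 2) :
    HasDerivWithinAt f f' s t := by
  rw [hasDerivWithinAt_iff_isLittleO]
  have h1 : (fun τ => f τ - f t - (τ - t) • f') =O[𝓝[s] t] fun τ => (τ - t) ^ 2 := by
    refine Asymptotics.IsBigO.of_bound C ?_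
    filter_upwards [self_mem_nhdsWithin] with τ hτ
    rw [Real.norm_of_nonneg (sq_nonneg (τ - t))]
    exact h τ hτ
  refine h1.trans_isLittleO ?_
  have h2 : Tendsto (fun τ => τ - t) (𝓝[s] t) (𝓝 0) := by
    have : Tendsto (fun τ => τ - t) (𝓝 t) (𝓝 (t - t)) := (continuous_sub_right t).tendsto t
    rw [sub_self] at this
    exact this.mono_left nhdsWithin_le_nhds
  have h3 := ((Asymptotics.isLittleO_one_iff ℝ).2 h2).mul_isBigO
    (Asymptotics.isBigO_refl (fun τ => τ - t) (𝓝[s] t))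
  simpa [sq] using h3

section solution

variable {Q A κ : ℝ} {c : ℤ → ℂ} {a : ℝ → ℤ → ℂ}

/-- The Taylor remainders are summable over `k`, so the series has a quadratic remainder too;
one-sided derivatives are included. -/
lemma IsFourierSolution.hasDerivWithinAt (h : IsFourierSolution Q A κ c a) {s : Set ℝ}
    (hs : s ⊆ Set.Ici 0) {t : ℝ} (ht : 0 ≤ t) (α : Torus) :
    HasDerivWithinAt (fun τ => realFourierSum (a τ) α)
      (realFourierSum (burgersField (a t)) α) s t := by
  refine hasDerivWithinAt_of_quadratic (C := κ * bracketMass) fun τ hτ => ?_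
  have h1 := hasSum_fourierSum ((h.decay τ (hs hτ)).summable (by norm_num)) α
  have h2 := hasSum_fourierSum ((h.decay t ht).summable (by norm_num)) α
  have h3 := (hasSum_fourierSum ((h.decay t ht).burgersField.summable (by norm_num)) α).mul_left
    ((τ - t : ℝ) : ℂ)
  have h4 := (h1.sub h2).sub h3
  have e : realFourierSum (a τ) α - realFourierSum (a t) α -
      (τ - t) • realFourierSum (burgersField (a t)) α =
      (fourierSum (a τ) α - fourierSum (a t) α -
        ((τ - t : ℝ) : ℂ) * fourierSum (burgersField (a t)) α).re := by
    rw [Complex.sub_re, Complex.sub_re, Complex.re_ofReal_mul]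
    rfl
  rw [e, ← h4.tsum_eq, Real.norm_eq_abs]
  refine (Complex.abs_re_le_norm _).trans ?_
  have hb := summable_bracket.hasSum.mul_left (κ * (τ - t) ^ 2)
  refine (tsum_of_norm_bounded hb fun k => ?_).trans_eq (by rw [bracketMass]; ring)
  have := h.deriv t ht τ (hs hτ) k
  calc _ = ‖a τ k - a t k - ((τ - t : ℝ) : ℂ) * burgersField (a t) k‖ * ‖fourier k α‖ := by
        rw [← norm_mul]; congr 1; ring
    _ ≤ _ := by rw [norm_fourier_apply, mul_one]; exact this.trans_eq (by ring)

lemma IsFourierSolution.tendsto_coeff (h : IsFourierSolution Q A κ c a) {s : Set ℝ}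
    (hs : s ⊆ Set.Ici 0) {t : ℝ} (ht : t ∈ s) (k : ℤ) :
    Tendsto (fun τ => a τ k) (𝓝[s] t) (𝓝 (a t k)) := by
  have : HasDerivWithinAt (fun τ => a τ k) (burgersField (a t) k) s t := by
    refine hasDerivWithinAt_of_quadratic (C := κ / (1 + |(k : ℝ)|) ^ 2) fun τ hτ => ?_
    rw [Complex.real_smul]
    exact (h.deriv t (hs ht) τ (hs hτ) k).trans_eq (by ring)
  exact this.continuousWithinAt

lemma IsFourierSolution.isQuadraticSolution (h : IsFourierSolution Q A κ c a) {u₀ : Torus → ℝ}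
    (hu₀ : MemLp u₀ 2 volume) (hc : ∀ k, hat u₀ k = c k) (T : ℝ) :
    IsQuadraticSolution T u₀ fun t => realFourierSum (a t) where
  initial := by
    have hs := (h.decay 0 le_rfl).summable (by norm_num)
    refine ae_eq_of_hat_eq (memLp_realFourierSum hs) hu₀ fun k => ?_
    rw [hat_realFourierSum hs (h.neg 0 le_rfl), hc, h.initial]
  equation t ht α := by
    have hd := h.decay t ht.1
    exact ⟨_, _, h.hasDerivWithinAt Set.Icc_subset_Ici_self ht.1 α,
      hasDerivAt_realFourierSum (hd.summable (by norm_num)) (hd.I_mul.summable (by norm_num)) α,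
      burgers_identity hd (h.neg t ht.1) α⟩

lemma sobolev_weight_mul_le {z : ℂ} (k : ℤ) (hz : k = 0 → z = 0) :
    (1 + (k : ℝ) ^ 2) ^ 4 * ‖z‖ ^ 2 ≤ 16 * (sobWeight 1 k * ‖z‖ ^ 2) := by
  rcases eq_or_ne k 0 with rfl | hk
  · simp [hz rfl]
  · have h1 : (1 : ℝ) ≤ (k : ℝ) ^ 2 := by
      have : (1 : ℝ) ≤ |(k : ℝ)| := by exact_mod_cast Int.one_le_abs hk
      rw [← sq_abs]; exact one_le_pow₀ this
    rw [sobWeight_one_intCast, ← mul_assoc]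
    gcongr
    calc (1 + (k : ℝ) ^ 2) ^ 4 ≤ (2 * (k : ℝ) ^ 2) ^ 4 := by gcongr; linarith
      _ = _ := by ring

lemma IsFourierSolution.summable_weighted (h : IsFourierSolution Q A κ c a) {t : ℝ} (ht : 0 ≤ t)
    {n : ℝ} (hn : 0 < n) : Summable fun k : ℤ => sobWeight n k * ‖a t k‖ ^ 2 :=
  summable_of_sum_le (fun k => mul_nonneg (sobWeight_nonneg hn _) (by positivity))
    (h.weighted_le t ht n hn)

lemma IsFourierSolution.memSobolev (h : IsFourierSolution Q A κ c a) {t : ℝ} (ht : 0 ≤ t) :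
    MemSobolev 4 (realFourierSum (a t)) := by
  have hs := (h.decay t ht).summable (by norm_num)
  refine ⟨memLp_realFourierSum hs, ?_⟩
  simp only [hat_realFourierSum hs (h.neg t ht)]
  exact .of_nonneg_of_le (fun k => by positivity)
    (fun k => sobolev_weight_mul_le k fun hk => by rw [hk, h.zero t ht])
    ((h.summable_weighted ht one_pos).mul_left 16)

/-- Dominated convergence: for fixed `k` the cutoff tends to zero. -/
lemma tendsto_tsum_sobWeight (hsum : Summable fun k : ℤ => sobWeight 1 k * ‖c k‖ ^ 2) :
    Tendsto (fun n : ℕ => ∑' k : ℤ, sobWeight n k * ‖c k‖ ^ 2) atTop (𝓝 0) := by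
  rw [← tsum_zero (β := ℤ) (α := ℝ)]
  refine tendsto_tsum_of_dominated_convergence hsum (fun k => ?_) ?_
  · have h1 : Tendsto (fun n : ℕ => |(k : ℝ)| / (n : ℝ)) atTop (𝓝 0) :=
      tendsto_const_div_atTop_nhds_zero_nat _
    have h2 : Tendsto (fun n : ℕ => cutWeight n k) atTop (𝓝 0) := by
      have := (tendsto_const_nhds (x := (1 : ℝ))).min h1
      rwa [min_eq_right zero_le_one] at this
    have := (h2.const_mul ((k : ℝ) ^ 8)).mul_const (‖c k‖ ^ 2)
    simpa [sobWeight] using this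
  · filter_upwards [eventually_gt_atTop 0] with n hn k
    rw [Real.norm_of_nonneg (mul_nonneg (sobWeight_nonneg (by exact_mod_cast hn) _) (by positivity))]
    gcongr
    exact sobWeight_le_one_intCast n k

/-- Beyond frequency `n` the cutoff is 1 and the two weights agree. -/
lemma sobWeight_one_mul_sub_le {n : ℕ} (hn : 0 < n) (k : ℤ) (z w : ℂ) :
    sobWeight 1 k * ‖z - w‖ ^ 2 ≤
      (if k ∈ Finset.Icc (-n : ℤ) n then sobWeight 1 k * ‖z - w‖ ^ 2 else 0) +
      2 * (sobWeight n k * ‖z‖ ^ 2 + sobWeight n k * ‖w‖ ^ 2) := by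
  have hn' : (0 : ℝ) < n := by exact_mod_cast hn
  have hW := sobWeight_nonneg hn' (k : ℝ)
  split_ifs with hk
  · have : 0 ≤ sobWeight n k * ‖z‖ ^ 2 + sobWeight n k * ‖w‖ ^ 2 := by positivity
    linarith
  · have hle : (n : ℝ) ≤ |(k : ℝ)| := by
      have : (n : ℤ) ≤ |k| := by
        rw [Finset.mem_Icc, not_and_or] at hk
        rcases hk with hk | hk
        · have := neg_le_abs k; omega
        · have := le_abs_self k; omega
      exact_mod_cast this
    have e : sobWeight n k = sobWeight 1 k := by
      rw [sobWeight_one_intCast, sobWeight, cutWeight, min_eq_left ((one_le_div hn').2 hle), mul_one]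
    have h2 : ‖z - w‖ ^ 2 ≤ 2 * (‖z‖ ^ 2 + ‖w‖ ^ 2) := by
      have := norm_sub_le z w
      nlinarith [sq_nonneg (‖z‖ - ‖w‖), norm_nonneg (z - w)]
    rw [e] at hW ⊢
    nlinarith

/-- Finitely many low modes converge one by one; the tails are small uniformly on `[0, T]` by the
weighted energy bound. -/
lemma IsFourierSolution.tendsto_tsum_sub (h : IsFourierSolution Q A κ c a)
    (hsum : Summable fun k : ℤ => sobWeight 1 k * ‖c k‖ ^ 2) (hr : 0 ≤ energyRate Q)
    {T t : ℝ} (ht : t ∈ Set.Icc 0 T) :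
    Tendsto (fun τ => ∑' k : ℤ, sobWeight 1 k * ‖a τ k - a t k‖ ^ 2) (𝓝[Set.Icc 0 T] t) (𝓝 0) := by
  rw [tendsto_order]
  have nonneg : ∀ τ, ∀ k : ℤ, 0 ≤ sobWeight 1 k * ‖a τ k - a t k‖ ^ 2 := fun τ k =>
    mul_nonneg (sobWeight_nonneg one_pos _) (by positivity)
  refine ⟨fun x hx => Eventually.of_forall fun τ => hx.trans_le (tsum_nonneg (nonneg τ)),
    fun ε hε => ?_⟩
  -- The factor 4 is 2 from squaring a difference, times the two times `τ` and `t`.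
  have htail : ∀ᶠ n : ℕ in atTop,
      4 * (Real.exp (energyRate Q * T) * ∑' k : ℤ, sobWeight n k * ‖c k‖ ^ 2) < ε / 2 := by
    have h1 := (((tendsto_tsum_sobWeight hsum).const_mul (Real.exp (energyRate Q * T))).const_mul 4)
    rw [mul_zero, mul_zero] at h1
    exact h1.eventually_lt_const (by linarith)
  obtain ⟨n, hn, hn0⟩ := (htail.and (eventually_gt_atTop 0)).exists
  have hn' : (0 : ℝ) < n := by exact_mod_cast hn0
  have hfin : Tendsto (fun τ => ∑ k ∈ Finset.Icc (-n : ℤ) n, sobWeight 1 k * ‖a τ k - a t k‖ ^ 2)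
      (𝓝[Set.Icc 0 T] t) (𝓝 0) := by
    have : Tendsto (fun τ => ∑ k ∈ Finset.Icc (-n : ℤ) n, sobWeight 1 k * ‖a τ k - a t k‖ ^ 2)
      (𝓝[Set.Icc 0 T] t) (𝓝 (∑ k ∈ Finset.Icc (-n : ℤ) n, sobWeight 1 k * ‖a t k - a t k‖ ^ 2)) :=
      tendsto_finsetSum _ fun k _ => (((h.tendsto_coeff Set.Icc_subset_Ici_self ht k).sub
        tendsto_const_nhds).norm.pow 2).const_mul _
    simpa using this
  have hE : ∀ τ ∈ Set.Icc 0 T, ∑' k : ℤ, sobWeight n k * ‖a τ k‖ ^ 2 ≤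
      Real.exp (energyRate Q * T) * ∑' k : ℤ, sobWeight n k * ‖c k‖ ^ 2 := fun τ hτ => by
    refine ((h.summable_weighted hτ.1 hn').tsum_le_of_sum_le (h.weighted_le τ hτ.1 n hn')).trans ?_
    have : 0 ≤ ∑' k : ℤ, sobWeight n k * ‖c k‖ ^ 2 :=
      tsum_nonneg fun k => mul_nonneg (sobWeight_nonneg hn' _) (by positivity)
    gcongr
    exact hτ.2
  filter_upwards [hfin.eventually_lt_const (half_pos hε), self_mem_nhdsWithin] with τ h1 hτ
  set S := Finset.Icc (-n : ℤ) n
  have s1 : HasSum (fun k : ℤ => if k ∈ S then sobWeight 1 k * ‖a τ k - a t k‖ ^ 2 else 0)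
      (∑ k ∈ S, sobWeight 1 k * ‖a τ k - a t k‖ ^ 2) := by
    rw [← Finset.sum_congr rfl fun k (hk : k ∈ S) =>
      if_pos (e := (0 : ℝ)) hk]
    exact hasSum_sum_of_ne_finset_zero fun k hk => if_neg hk
  have s2 := ((h.summable_weighted hτ.1 hn').hasSum.add
    (h.summable_weighted ht.1 hn').hasSum).mul_left 2
  have hle := (s1.add s2).summable.of_nonneg_of_le (nonneg τ) fun k =>
    sobWeight_one_mul_sub_le hn0 k (a τ k) (a t k)
  have := hle.tsum_le_tsum (fun k => sobWeight_one_mul_sub_le hn0 k (a τ k) (a t k))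
    (s1.add s2).summable
  rw [(s1.add s2).tsum_eq] at this
  linarith [hE τ hτ, hE t ht]

lemma IsFourierSolution.continuousInSobolev (h : IsFourierSolution Q A κ c a)
    (hsum : Summable fun k : ℤ => sobWeight 1 k * ‖c k‖ ^ 2) (hr : 0 ≤ energyRate Q) (T : ℝ) :
    ContinuousInSobolev 4 T fun t => realFourierSum (a t) := by
  refine ⟨fun t ht => h.memSobolev ht.1, fun t ht => ?_⟩
  have hs : ∀ τ, 0 ≤ τ → Summable fun k => ‖a τ k‖ := fun τ hτ => (h.decay τ hτ).summable (by norm_num)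
  have hhat : ∀ τ, 0 ≤ τ → ∀ k,
      hat (fun α => realFourierSum (a τ) α - realFourierSum (a t) α) k = a τ k - a t k := by
    intro τ hτ k
    have e : (fun α => realFourierSum (a τ) α - realFourierSum (a t) α) =
        realFourierSum fun k => a τ k - a t k := by
      funext α
      rw [realFourierSum, realFourierSum, ← Complex.sub_re, fourierSum_sub (hs τ hτ) (hs t ht.1)]
      rfl
    rw [e]
    refine hat_realFourierSum (((hs τ hτ).add (hs t ht.1)).of_nonneg_of_le
      (fun _ => norm_nonneg _) fun k => norm_sub_le _ _) (fun k => ?_) k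
    rw [h.neg τ hτ, h.neg t ht.1, star_sub]
  have lim : Tendsto (fun τ => √(2 * Real.pi *
      (16 * ∑' k : ℤ, sobWeight 1 k * ‖a τ k - a t k‖ ^ 2))) (𝓝[Set.Icc 0 T] t) (𝓝 0) := by
    have := (((h.tendsto_tsum_sub hsum hr ht).const_mul 16).const_mul (2 * Real.pi)).sqrt
    simpa using this
  refine tendsto_of_tendsto_of_tendsto_of_le_of_le' tendsto_const_nhds lim
    (Eventually.of_forall fun τ => Real.sqrt_nonneg _) ?_
  filter_upwards [self_mem_nhdsWithin] with τ hτ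
  unfold sobolevNorm
  simp only [hhat τ hτ.1]
  have s3 : Summable fun k : ℤ => 16 * (sobWeight 1 k * ‖a τ k - a t k‖ ^ 2) := by
    refine Summable.mul_left 16 (.of_nonneg_of_le
      (fun k => mul_nonneg (sobWeight_nonneg one_pos _) (by positivity))
      (fun k => (sobWeight_one_mul_sub_le one_pos k (a τ k) (a t k)))
      (Summable.add (summable_of_hasFiniteSupport ?_) (((h.summable_weighted hτ.1 ?_).add
        (h.summable_weighted ht.1 ?_)).mul_left 2)))
    · exact (Finset.finite_toSet (Finset.Icc (-(1 : ℕ) : ℤ) (1 : ℕ))).subset fun k hk => by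
        by_contra hk'
        exact hk (if_neg hk')
    all_goals norm_num
  have hle : ∀ k : ℤ, (1 + (k : ℝ) ^ 2) ^ 4 * ‖a τ k - a t k‖ ^ 2 ≤
      16 * (sobWeight 1 k * ‖a τ k - a t k‖ ^ 2) := fun k =>
    sobolev_weight_mul_le k fun hk => by rw [hk, h.zero τ hτ.1, h.zero t ht.1, sub_zero]
  have := (s3.of_nonneg_of_le (fun k => by positivity) hle).tsum_le_tsum hle s3
  rw [tsum_mul_left] at this
  gcongr

lemma IsFourierSolution.eLpNorm_le (h : IsFourierSolution Q A κ c a) (hQ : 0 < Q) {t : ℝ}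
    (ht : 0 ≤ t) : eLpNorm (realFourierSum (a t)) 2 volume ≤
      ENNReal.ofReal (√(2 * Real.pi) * (32 * Q) ^ 4 * (1 + t) ^ (-2.25 : ℝ)) := by
  rw [eLpNorm_realFourierSum ((h.decay t ht).summable (by norm_num)) (h.neg t ht)]
  apply ENNReal.ofReal_le_ofReal
  have h1 : ∑' k, ‖a t k‖ ^ 2 ≤ (32 * Q / (1 + t)) ^ 8 :=
    (summable_of_sum_le (fun k => by positivity) (h.l2_le t ht)).tsum_le_of_sum_le (h.l2_le t ht)
  have h1t : 1 ≤ 1 + t := by linarith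
  calc √(2 * Real.pi * ∑' k, ‖a t k‖ ^ 2)
      ≤ √(2 * Real.pi * (((32 * Q) / (1 + t)) ^ 4) ^ 2) := by
        rw [← pow_mul]; gcongr
    _ = √(2 * Real.pi) * (32 * Q) ^ 4 * (1 + t) ^ (-4 : ℝ) := by
        rw [Real.sqrt_mul (by positivity), Real.sqrt_sq (by positivity), Real.rpow_neg (by linarith),
          div_pow, mul_assoc, ← div_eq_mul_inv]
        norm_num
    -- The rate obtained is `-4`; since `1 + t ≥ 1` it implies the exponent `-2.25`.
    _ ≤ _ := by
        gcongr
        norm_num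

end solution

/-! ### Choice of constants and conclusion -/

theorem mainTheorem3 :
    ∃ ε : ℝ, 0 < ε ∧ ∃ C : ℝ, 0 < C ∧
      ∀ u₀ : Torus → ℝ, MemHomSobolev 4 u₀ → (∫ α : Torus, u₀ α) = 0 →
        homSobolevNorm 4 u₀ ≤ ε →
        ∃ u : ℝ → Torus → ℝ,
          (∀ T : ℝ, 0 < T →
            ContinuousInSobolev 4 T u ∧ IsQuadraticSolution T u₀ u) ∧
          ∀ t : ℝ, 0 ≤ t →
            eLpNorm (u t) 2 volume ≤ ENNReal.ofReal (C * (1 + t) ^ (-2.25 : ℝ)) := by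
  have hK := energyConst_nonneg
  -- As `Q ≤ 1`, `12 K Q ^ 4 ≤ (12 K + 1) Q = 1`.
  set Q : ℝ := 1 / (12 * energyConst + 1) with hQdef
  have hQ : 0 < Q := by positivity
  have hQ1 : Q ≤ 1 := by rw [hQdef, div_le_one (by positivity)]; linarith
  have hKQ : 12 * energyConst * Q ^ 4 ≤ 1 := by
    calc 12 * energyConst * Q ^ 4 ≤ (12 * energyConst + 1) * Q := by
          gcongr
          · linarith
          · exact pow_le_of_le_one hQ.le hQ1 (by norm_num)
      _ = 1 := by rw [hQdef]; field_simp
  have hr : 0 ≤ energyRate Q := mul_nonneg hK (Real.sqrt_nonneg _)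
  refine ⟨Q ^ 4, by positivity, √(2 * Real.pi) * (32 * Q) ^ 4, by positivity,
    fun u₀ hu₀ hmean hnorm => ?_⟩
  have hw : ∀ k : ℤ, |(k : ℝ)| ^ (2 * 4) * ‖hat u₀ k‖ ^ 2 = sobWeight 1 k * ‖hat u₀ k‖ ^ 2 :=
    fun k => by
      rw [sobWeight_one_intCast, ← abs_pow, abs_of_nonneg (Even.pow_nonneg (by decide) _)]
  have hsum : Summable fun k : ℤ => sobWeight 1 k * ‖hat u₀ k‖ ^ 2 := by
    simpa only [hw] using hu₀.2
  -- The norm bound `Q ^ 4` gives `2π ∑ ≤ Q ^ 8`, and `2π ≥ 2` leaves the half reserved for the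
  -- auxiliary exponential.
  have hsmall : ∑' k : ℤ, sobWeight 1 k * ‖hat u₀ k‖ ^ 2 ≤ Q ^ 8 / 2 := by
    unfold homSobolevNorm at hnorm
    simp only [hw] at hnorm
    rw [Real.sqrt_le_left (by positivity)] at hnorm
    have h0 : 0 ≤ ∑' k : ℤ, sobWeight 1 k * ‖hat u₀ k‖ ^ 2 :=
      tsum_nonneg fun k => mul_nonneg (sobWeight_nonneg one_pos _) (by positivity)
    have hpi := Real.pi_gt_three
    nlinarith
  obtain ⟨a, ha⟩ := exists_isFourierSolution hQ hKQ (hat_zero u₀ hmean) (hat_neg u₀) hsum hsmall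
  exact ⟨fun t => realFourierSum (a t), fun T _ => ⟨ha.continuousInSobolev hsum hr T,
    ha.isQuadraticSolution hu₀.1 (fun _ => rfl) T⟩, fun t ht => ha.eLpNorm_le hQ ht⟩
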